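/- **Global well-posedness in the continuum model.** *Setting.* Let $SO(3)$ carry the Riemannian metric $\langle RA,RB\rangle=\tfrac12\operatorname{tr}(A^TB)$ ($A,B$ skew-symmetric $3\times3$ matrices), with geodesic distance $d(R,Q)=\arccos\big(\tfrac{\operatorname{tr}(R^TQ)-1}{2}\big)$, and let $\nabla$ be the Riemannian gradient. Fix $\varepsilon>0$ and put $$\mathcal D_\varepsilon=\{R\in SO(3): d(I,R)<\tfrac{\pi}{2}-\varepsilon\},\qquad \overline D_r=\{R\in SO(3): d(I,R)\le r\}.$$ Let $\mathcal P(\mathcal D_\varepsilon)$ be the set of Borel probability measures on $\mathcal D_\varepsilon$ with the narrow topology (convergence of integrals of bounded continuous functions on $\mathcal D_\varepsilon$), and $C([0,\infty);\mathcal P(\mathcal D_\varepsilon))$ the set of continuous curves in it. Let $K(R,Q)=g(d(R,Q)^2)$ for all $R,Q\in SO(3)$, where $g:[0,\infty)\to\mathbb R$ is differentiable with locally Lipschitz continuous derivative $g'$. For a curve $\rho=(\rho_t)_{t\ge0}$ in $\mathcal P(\mathcal D_\varepsilon)$ define the velocity field $$v[\rho](R,t)=-\int_{\mathcal D_\varepsilon}\nabla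 K_Q(R)\,d\rho_t(Q),\qquad K_Q(R)=K(R,Q),\qquad R\in\mathcal D_\varepsilon,\ t\ge0 .$$ A flow map generated by $v[\rho]$ on $\operatorname{supp}(\rho_0)\times[0,\infty)$ is a map $\Psi:\operatorname{supp}(\rho_0)\times[0,\infty)\to\mathcal D_\varepsilon$ such that $\Psi^0(R)=R$ and $\frac{d}{dt}\Psi^t(R)=v[\rho](\Psi^t(R),t)$ for all $R\in\operatorname{supp}(\rho_0)$ and $t\ge0$. The curve $\rho$ is a *global weak solution* of the aggregation equation $\partial_t\rho+\nabla\cdot(\rho v)=0$, $v=-\nabla K*\rho$, if $v[\rho]$ generates a unique flow map $\Psi$ on $\operatorname{supp}(\rho_0)\times[0,\infty)$ and $\rho_t=\Psi^t\#\rho_0$ (push-forward) for all $t\ge 0$. *Statement.* Assume in addition that $g'\ge0$, and let $\rho_0\in\mathcal P(\mathcal D_\varepsilon)$ satisfy $\operatorname{supp}(\rho_0)\subset\overline D_r$ for some $r<\pi/2-\varepsilon$. Then there exists a unique global weak solution $\rho$ in $C([0,\infty);\mathcal P(\mathcal D_\varepsilon))$ that starts from $\rho_0$; moreover, $\operatorname{supp}(\rho_t)\subset\overline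 D_r$ for all $t\in[0,\infty)$. -/

import Mathlib

open MeasureTheory Set
open scoped Matrix NNReal

noncomputable section

namespace AggSO3

/-- The rotation group `SO(3)`, with the topology of the ambient space of `3 × 3` matrices. -/
abbrev SO3 : Type := Matrix.specialOrthogonalGroup (Fin 3) ℝ

/-- The Borel σ-algebra of `SO(3)`. -/
instance : MeasurableSpace SO3 := borel SO3

instance : BorelSpace SO3 := ⟨rfl⟩

/-- The matrix of a rotation. -/
def mat (R : SO3) : Matrix (Fin 3) (Fin 3) ℝ := R.1

/-- Geodesic distance on `SO(3)` for the metric `⟨RA, RB⟩ = tr(Aᵀ B) / 2`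
(the rotation angle of `Rᵀ Q`). -/
def dist (R Q : SO3) : ℝ :=
  Real.arccos ((((mat R)ᵀ * mat Q).trace - 1) / 2)

/-- The open geodesic disk of radius `r` centred at the identity. -/
def disk (r : ℝ) : Set SO3 := {Q | dist 1 Q < r}

/-- The closed geodesic disk of radius `r` centred at the identity. -/
def closedDisk (r : ℝ) : Set SO3 := {Q | dist 1 Q ≤ r}

/-- The disk `𝒟_ε` of radius `π / 2 - ε` centred at the identity. -/
abbrev D (ε : ℝ) : Set SO3 := disk (Real.pi / 2 - ε)

/-- The skew-symmetric matrix of the vector `v`, i.e. `hat v *ᵥ w = v × w`. -/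
def hat (v : Fin 3 → ℝ) : Matrix (Fin 3) (Fin 3) ℝ :=
  !![0, -v 2, v 1; v 2, 0, -v 0; -v 1, v 0, 0]

/-- The skew-symmetric matrices `hat e₀, hat e₁, hat e₂`. They form an orthonormal basis of
`𝔰𝔬(3)` for `⟨A, B⟩ = tr(Aᵀ B) / 2`. -/
def basisSkew (i : Fin 3) : Matrix (Fin 3) (Fin 3) ℝ := hat (Pi.single i 1)

theorem axis_mem (i : Fin 3) (s : ℝ) :
    1 + Real.sin s • basisSkew i + (1 - Real.cos s) • basisSkew i ^ 2 ∈
      Matrix.specialOrthogonalGroup (Fin 3) ℝ := by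
  have h := Real.sin_sq_add_cos_sq s
  rw [Matrix.mem_specialOrthogonalGroup_iff]
  constructor
  · rw [Matrix.mem_orthogonalGroup_iff]
    ext a b
    fin_cases i <;> fin_cases a <;> fin_cases b <;>
      simp [basisSkew, hat, Matrix.mul_apply, Fin.sum_univ_three, pow_two] <;>
      linarith
  · fin_cases i <;>
      simp [basisSkew, hat, Matrix.det_fin_three, pow_two] <;>
      linarith

/-- The rotation `exp (s hat eᵢ) = I + sin s hat eᵢ + (1 - cos s) (hat eᵢ)²` by the angle `s`
about the `i`-th coordinate axis (Rodrigues' formula). -/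
def axisRot (i : Fin 3) (s : ℝ) : SO3 :=
  ⟨1 + Real.sin s • basisSkew i + (1 - Real.cos s) • basisSkew i ^ 2, axis_mem i s⟩

/-- The Riemannian gradient at `R` of a function `φ` on `SO(3)`, as a tangent vector
`R A`, with `A` skew-symmetric, in the space of `3 × 3` matrices. The vectors `R hat eᵢ` form an
orthonormal basis of the tangent space at `R`, and `s ↦ R exp (s hat eᵢ)` is the geodesic that
leaves `R` with velocity `R hat eᵢ`. -/
def grad (φ : SO3 → ℝ) (R : SO3) : Matrix (Fin 3) (Fin 3) ℝ :=
  ∑ i, deriv (fun s : ℝ => φ (R * axisRot i s)) 0 • (mat R * basisSkew i)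

/-- The interaction velocity field `v[ρ] = -∇K * ρ` on `U × [0, ∞)`, that is
`v[ρ](R, t) = -∫ ∇K_Q(R) dρ_t(Q)` with `K_Q(R) = K(R, Q)`, as a matrix (integrated entrywise). -/
def velocity {U : Set SO3} (K : SO3 → SO3 → ℝ) (ρ : ℝ≥0 → ProbabilityMeasure U)
    (R : U) (t : ℝ≥0) : Matrix (Fin 3) (Fin 3) ℝ :=
  fun i j => -∫ Q : U, grad (fun S => K S Q) R i j ∂(ρ t : Measure U)

/-- `Ψ : Σ × [0, ∞) → U` is a flow map generated by the time-dependent vector field `X` on `U`: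
`Ψ^0(R) = R` and `d/dt Ψ^t(R) = X(Ψ^t(R), t)` for all `R ∈ Σ` and `t ≥ 0`
(a one-sided derivative at `t = 0`). -/
def IsGlobalFlowMap {U : Set SO3} (X : U → ℝ≥0 → Matrix (Fin 3) (Fin 3) ℝ) (S : Set U)
    (Ψ : S → ℝ≥0 → U) : Prop :=
  ∀ R : S, Ψ R 0 = R ∧
    ∀ (t : ℝ≥0) (i j : Fin 3),
      HasDerivWithinAt (fun s : ℝ => mat (Ψ R s.toNNReal) i j) (X (Ψ R t) t i j) (Ici 0) t

/-- Global weak solutions in `𝒫(U)`: the velocity field `v[ρ]` generates a unique flow map `Ψ` on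
`supp ρ₀ × [0, ∞)` and `ρ_t` is the push-forward of `ρ₀` by `Ψ^t` for all `t ≥ 0`. -/
def IsGlobalWeakSolution {U : Set SO3} (K : SO3 → SO3 → ℝ) (ρ : ℝ≥0 → ProbabilityMeasure U) :
    Prop :=
  ∃ Ψ : (ρ 0 : Measure U).support → ℝ≥0 → U,
    IsGlobalFlowMap (velocity K ρ) (ρ 0 : Measure U).support Ψ ∧
    (∀ Φ, IsGlobalFlowMap (velocity K ρ) (ρ 0 : Measure U).support Φ → Φ = Ψ) ∧
    ∀ t : ℝ≥0, Measurable (fun R => Ψ R t) ∧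
      (ρ t : Measure U) =
        ((ρ 0 : Measure U).comap Subtype.val).map (fun R => Ψ R t)

end AggSO3

end

/-! A rotation by an angle `θ < π` about the unit axis `n` is encoded by its Rodrigues vector `x =
tan(θ/2) n`. This is the gnomonic projection of the unit quaternions, so geodesics become straight
segments, and disks about the identity become Euclidean balls about the origin. Radii below `π/2`
give balls of radius `κ < 1`, where `1 + ⟨x, y⟩ > 0`: two such rotations are never at distance `π`.

In this chart `-∇K_Q` at `R` is a scalar multiple of `y - x` (`grad_rot`). The scalar is nonnegative
when `g' ≥ 0`, and the resulting `force` is Lipschitz on the ball, also across the diagonal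
(`exists_force_lipschitz`), because the squared distance is a smooth function of `tan²(θ/2)` down to
zero.

Existence: the unknown is the whole map from `supp ρ₀` to the ball, evolving by `∂ₜ X(p) = ∫
force(X(p), X(q)) dρ₀(q)`. After composing the force with the radial projection this is a bounded
Lipschitz ODE in a Banach space of bounded continuous maps, hence globally solvable. Attraction
towards points of a ball cannot push a particle out of it, so the truncation is never active
(`exists_meanField_solution_of_attractive`), and pushing `ρ₀` forward gives the solution.

Uniqueness: two solutions are push-forwards of the same `ρ₀`, so their velocities differ by at most
a constant times the uniform distance of their flow maps, and a Grönwall argument makes the flows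
equal (`weakSolution_unique`). -/

noncomputable section

namespace AggSO3

open Filter Topology Metric

/-! ### Global existence and uniqueness for ODEs in Banach spaces. -/

section ODE

variable {E : Type*} [NormedAddCommGroup E] [NormedSpace ℝ E]

/-- Two families of curves with the same initial values coincide if the uniform distance of their
velocities is controlled by the uniform distance of their positions. -/
theorem eqOn_of_norm_deriv_sub_le {ι : Type*} {f g f' g' : ι → ℝ → E} {C b : ℝ}
    (hf : ∀ i t, 0 ≤ t → HasDerivWithinAt (f i) (f' i t) (Ici 0) t)
    (hg : ∀ i t, 0 ≤ t → HasDerivWithinAt (g i) (g' i t) (Ici 0) t)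
    (h0 : ∀ i, f i 0 = g i 0)
    (hC : 0 ≤ C)
    (hb : ∀ i t, 0 ≤ t → ‖f i t - g i t‖ ≤ b)
    (bound : ∀ t, 0 ≤ t → ∀ c, (∀ j, ‖f j t - g j t‖ ≤ c) → ∀ i, ‖f' i t - g' i t‖ ≤ C * c) :
    ∀ i t, 0 ≤ t → f i t = g i t := by
  intro i₀ t₀ ht₀
  have hb0 : 0 ≤ b := (norm_nonneg _).trans (hb i₀ 0 le_rfl)
  -- The supremum over `i` need not be differentiable in `t`, so Grönwall is replaced by an
  -- iteration. The weight `exp (2Ct)` makes each integration of the bound `C * (b / 2 ^ n) * exp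
  -- (2Cs)` gain a factor `1/2`.
  have key : ∀ n : ℕ, ∀ i t, 0 ≤ t → ‖f i t - g i t‖ ≤ b / 2 ^ n * Real.exp (2 * C * t) := by
    intro n
    induction n with
    | zero =>
      intro i t ht
      refine (hb i t ht).trans ?_
      have : 1 ≤ Real.exp (2 * C * t) := Real.one_le_exp (by positivity)
      simpa using le_mul_of_one_le_right hb0 this
    | succ n ih =>
      intro i t ht
      have hd : ∀ s, 0 ≤ s → HasDerivWithinAt (fun s => f i s - g i s) (f' i s - g' i s)
          (Ici 0) s := fun s hs => (hf i s hs).sub (hg i s hs)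
      refine image_norm_le_of_norm_deriv_right_le_deriv_boundary
        (f := fun s => f i s - g i s) (f' := fun s => f' i s - g' i s) (a := 0) (b := t)
        (B := fun s => b / 2 ^ (n + 1) * Real.exp (2 * C * s))
        (B' := fun s => C * (b / 2 ^ n * Real.exp (2 * C * s)))
        (fun s hs => (hd s hs.1).continuousWithinAt.mono Icc_subset_Ici_self)
        (fun s hs => (hd s hs.1).mono (Ici_subset_Ici.2 hs.1)) ?_ ?_ ?_ (right_mem_Icc.2 ht)
      · simp only [h0, sub_self, norm_zero]
        positivity
      · intro s
        have h := (((hasDerivAt_id s).const_mul (2 * C)).exp).const_mul (b / 2 ^ (n + 1))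
        refine h.congr_deriv ?_
        simp only [id, pow_succ]
        field_simp
      · intro s hs
        exact bound s hs.1 _ (fun j => ih j s hs.1) i
  have hlim : Tendsto (fun n : ℕ => b / 2 ^ n * Real.exp (2 * C * t₀)) atTop (𝓝 0) := by
    have h := ((tendsto_pow_atTop_nhds_zero_of_lt_one (r := (1 / 2 : ℝ)) (by norm_num)
      (by norm_num)).const_mul b).mul_const (Real.exp (2 * C * t₀))
    simpa [div_eq_mul_inv] using h
  have := ge_of_tendsto' hlim (fun n => key n i₀ t₀ ht₀)
  exact sub_eq_zero.1 (norm_le_zero_iff.1 this)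

/-- A bounded Lipschitz vector field on a Banach space has global solutions forward in time. -/
theorem exists_global_solution [CompleteSpace E] {G : E → E} {K M : ℝ≥0}
    (hG : LipschitzWith K G) (hM : ∀ x, ‖G x‖ ≤ M) (x₀ : E) :
    ∃ X : ℝ → E, X 0 = x₀ ∧ ∀ t, 0 ≤ t → HasDerivWithinAt X (G (X t)) (Ici 0) t := by
  -- As `M` bounds `G` everywhere, the Picard–Lindelöf ball may have radius `M * (n + 1)`, which
  -- permits the time interval `[0, n + 1]`.
  have hloc : ∀ n : ℕ, ∃ α : ℝ → E, α 0 = x₀ ∧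
      ∀ t ∈ Icc (0 : ℝ) (n + 1), HasDerivWithinAt α (G (α t)) (Icc 0 (n + 1 : ℝ)) t := by
    intro n
    have hn : (0 : ℝ) ≤ n + 1 := by positivity
    have hp : IsPicardLindelof (fun _ : ℝ => G) (⟨0, left_mem_Icc.2 hn⟩ : Icc (0 : ℝ) (n + 1)) x₀
        (M * (n + 1)) 0 M K :=
      IsPicardLindelof.of_time_independent (fun x _ => hM x) hG.lipschitzOnWith
        (by simp [max_eq_left hn])
    exact hp.exists_eq_forall_mem_Icc_hasDerivWithinAt₀
  choose α hα0 hα using hloc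
  have huniq : ∀ m n : ℕ, m ≤ n → ∀ t ∈ Icc (0 : ℝ) (m + 1), α m t = α n t := by
    intro m n hmn
    have hmn' : (m : ℝ) + 1 ≤ n + 1 := by gcongr
    have hsub : Icc (0 : ℝ) (m + 1) ⊆ Icc (0 : ℝ) (n + 1) := Icc_subset_Icc_right hmn'
    have hcl : ∀ k : ℕ, (k : ℝ) + 1 ≤ n + 1 → ∀ t ∈ Ico (0 : ℝ) (k + 1),
        HasDerivWithinAt (α k) (G (α k t)) (Ici t) t := by
      intro k _ t ht
      refine (hα k t (Ico_subset_Icc_self ht)).mono_of_mem_nhdsWithin ?_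
      exact mem_of_superset (Icc_mem_nhdsGE ht.2) (Icc_subset_Icc_left ht.1)
    refine ODE_solution_unique_of_mem_Icc_right (v := fun _ => G) (s := fun _ => univ) (K := K)
      (fun t _ => hG.lipschitzOnWith)
      (fun t ht => (hα m t ht).continuousWithinAt) (hcl m hmn') (fun _ _ => mem_univ _)
      (fun t ht => ((hα n t (hsub ht)).continuousWithinAt).mono hsub)
      (fun t ht => hcl n le_rfl t ⟨ht.1, ht.2.trans_le hmn'⟩) (fun _ _ => mem_univ _) ?_
    rw [hα0, hα0]
  have hX : ∀ n : ℕ, ∀ t ∈ Icc (0 : ℝ) (n + 1), α ⌈t⌉₊ t = α n t := by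
    intro n t ht
    rcases le_total ⌈t⌉₊ n with h | h
    · exact huniq _ _ h t ⟨ht.1, (Nat.le_ceil t).trans (by linarith)⟩
    · exact (huniq _ _ h t ht).symm
  refine ⟨fun t => α ⌈t⌉₊ t, by simp [hα0], fun t ht => ?_⟩
  -- The interval `[0, n + 1]` extends strictly beyond `t ≤ ⌈t⌉₊`, so near `t` the glued curve
  -- agrees with the single solution `α n`.
  set n := ⌈t⌉₊ with hn
  have htn : t < n + 1 := (Nat.le_ceil t).trans_lt (lt_add_one _)
  have h1 : HasDerivWithinAt (α n) (G (α n t)) (Ici 0) t := by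
    refine (hα n t ⟨ht, htn.le⟩).mono_of_mem_nhdsWithin ?_
    rw [← Ici_inter_Iic]
    exact inter_mem_nhdsWithin _ (Iic_mem_nhds htn)
  refine h1.congr_of_eventuallyEq ?_ rfl
  filter_upwards [self_mem_nhdsWithin, mem_nhdsWithin_of_mem_nhds (Iio_mem_nhds htn)] with s hs hs'
  exact hX n s ⟨hs, le_of_lt hs'⟩

end ODE

/-! ### Mean-field ODEs and the radial retraction. -/

section MeanField

variable {E : Type*} [NormedAddCommGroup E] [NormedSpace ℝ E]

/-- The mean-field ODE `∂ₜ X(p) = ∫ F(X(p), X(q)) dμ(q)` with a bounded Lipschitz interaction `F`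
has global solutions. -/
theorem exists_meanField_solution [CompleteSpace E] [SecondCountableTopology E]
    {S : Type*} [TopologicalSpace S] [MeasurableSpace S] [OpensMeasurableSpace S]
    (μ : Measure S) [IsProbabilityMeasure μ] {F : E → E → E} {L M : ℝ≥0}
    (hF : ∀ x x' y y', ‖F x y - F x' y'‖ ≤ L * (‖x - x'‖ + ‖y - y'‖)) (hM : ∀ x y, ‖F x y‖ ≤ M)
    (X₀ : BoundedContinuousFunction S E) :
    ∃ X : S → ℝ → E, (∀ p, X p 0 = X₀ p) ∧ (∀ t, Continuous fun p => X p t) ∧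
      ∀ p t, 0 ≤ t → HasDerivWithinAt (X p) (∫ q, F (X p t) (X q t) ∂μ) (Ici 0) t := by
  have hFx : ∀ x, Continuous (F x) := fun x =>
    (LipschitzWith.of_dist_le_mul (K := L) fun y y' => by
      simpa [dist_eq_norm] using hF x x y y').continuous
  have hint : ∀ x (Y : BoundedContinuousFunction S E), Integrable (fun q => F x (Y q)) μ :=
    fun x Y => Integrable.of_bound ((hFx x).comp Y.continuous).aestronglyMeasurable (M : ℝ)
      (ae_of_all _ fun q => hM _ _)
  have hdiff : ∀ x x' (Y Y' : BoundedContinuousFunction S E),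
      ‖∫ q, F x (Y q) ∂μ - ∫ q, F x' (Y' q) ∂μ‖ ≤ L * (‖x - x'‖ + ‖Y - Y'‖) := by
    intro x x' Y Y'
    rw [← integral_sub (hint _ _) (hint _ _)]
    refine (norm_integral_le_of_norm_le_const (C := L * (‖x - x'‖ + ‖Y - Y'‖))
      (ae_of_all _ fun q => (hF _ _ _ _).trans ?_)).trans (by simp)
    gcongr
    exact (Y - Y').norm_coe_le_norm q
  have hbd : ∀ x (Y : BoundedContinuousFunction S E), ‖∫ q, F x (Y q) ∂μ‖ ≤ M := fun x Y =>
    (norm_integral_le_of_norm_le_const (ae_of_all _ fun q => hM _ _)).trans (by simp)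
  -- All particles move at once as a point of the space of bounded continuous maps; continuity in
  -- the label `p` is then automatic.
  let G : BoundedContinuousFunction S E → BoundedContinuousFunction S E := fun Y =>
    BoundedContinuousFunction.ofNormedAddCommGroup (fun p => ∫ q, F (Y p) (Y q) ∂μ)
      ((LipschitzWith.of_dist_le_mul (K := L) fun x x' => by
        simpa [dist_eq_norm] using hdiff x x' Y Y :
          LipschitzWith L fun x => ∫ q, F x (Y q) ∂μ).continuous.comp Y.continuous)
      M (fun p => hbd _ _)
  have hGM : ∀ Y, ‖G Y‖ ≤ M := fun Y =>
    (BoundedContinuousFunction.norm_le M.2).2 fun p => hbd _ _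
  have hGL : LipschitzWith (2 * L) G := by
    refine LipschitzWith.of_dist_le_mul fun Y Y' => ?_
    rw [BoundedContinuousFunction.dist_le (by positivity)]
    intro p
    rw [dist_eq_norm, dist_eq_norm]
    refine (hdiff (Y p) (Y' p) Y Y').trans ?_
    have := (Y - Y').norm_coe_le_norm p
    have hL := L.2
    push_cast
    rw [BoundedContinuousFunction.sub_apply] at this
    nlinarith
  obtain ⟨X, hX0, hX⟩ := exists_global_solution hGL hGM X₀
  refine ⟨fun p t => X t p, fun p => DFunLike.congr_fun hX0 p, fun t => (X t).continuous, fun p t ht => ?_⟩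
  exact ((BoundedContinuousFunction.evalCLM ℝ p).hasFDerivAt.comp_hasDerivWithinAt t (hX t ht))

/-- The radial retraction of a normed space onto the closed ball of radius `κ`. -/
def radialProj (κ : ℝ) (x : E) : E := (κ / max κ ‖x‖) • x

theorem radialProj_of_le {κ : ℝ} {x : E} (hx : ‖x‖ ≤ κ) : radialProj κ x = x := by
  rcases (norm_nonneg x).trans hx |>.eq_or_lt with h | h
  · have : x = 0 := by rw [← norm_le_zero_iff]; linarith
    simp [radialProj, this]
  · rw [radialProj, max_eq_left hx, div_self h.ne', one_smul]

theorem norm_radialProj_le {κ : ℝ} (hκ : 0 ≤ κ) (x : E) : ‖radialProj κ x‖ ≤ κ := by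
  rw [radialProj, norm_smul, Real.norm_of_nonneg (by positivity)]
  have h1 : ‖x‖ ≤ max κ ‖x‖ := le_max_right _ _
  rcases (norm_nonneg x).trans h1 |>.eq_or_lt with h | h
  · simp [← h, hκ]
  · rw [div_mul_eq_mul_div, div_le_iff₀ h]
    gcongr

/-- One `‖x - y‖` comes from scaling the difference by a factor at most 1, the other from the change
of the scaling factor. -/
theorem norm_radialProj_sub_le {κ : ℝ} (hκ : 0 ≤ κ) (x y : E) :
    ‖radialProj κ x - radialProj κ y‖ ≤ 2 * ‖x - y‖ := by
  have hκx : κ ≤ max κ ‖x‖ := le_max_left _ _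
  have hκy : κ ≤ max κ ‖y‖ := le_max_left _ _
  rcases hκ.eq_or_lt with rfl | hκ
  · simp [radialProj]
  have hx : 0 < max κ ‖x‖ := hκ.trans_le hκx
  have hy : 0 < max κ ‖y‖ := hκ.trans_le hκy
  have h1 : radialProj κ x - radialProj κ y
      = (κ / max κ ‖x‖) • (x - y) + (κ / max κ ‖x‖ - κ / max κ ‖y‖) • y := by
    simp only [radialProj]
    module
  have h2 : ‖(κ / max κ ‖x‖) • (x - y)‖ ≤ ‖x - y‖ := by
    rw [norm_smul, Real.norm_of_nonneg (by positivity)]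
    exact mul_le_of_le_one_left (norm_nonneg _) ((div_le_one hx).2 hκx)
  have h3 : ‖(κ / max κ ‖x‖ - κ / max κ ‖y‖) • y‖ ≤ ‖x - y‖ := by
    have h4 : κ / max κ ‖x‖ - κ / max κ ‖y‖
        = (max κ ‖y‖ - max κ ‖x‖) * (κ / max κ ‖x‖ * (max κ ‖y‖)⁻¹) := by
      field_simp
    have h5 : |max κ ‖y‖ - max κ ‖x‖| ≤ ‖x - y‖ := by
      have := abs_max_sub_max_le_abs ‖y‖ ‖x‖ κ
      rw [max_comm κ, max_comm κ, norm_sub_rev]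
      exact this.trans (abs_norm_sub_norm_le _ _)
    rw [norm_smul, h4, norm_mul, Real.norm_eq_abs, Real.norm_of_nonneg (by positivity), mul_assoc]
    refine (mul_le_of_le_one_right (abs_nonneg _) ?_).trans h5
    rw [mul_assoc]
    refine mul_le_one₀ ((div_le_one hx).2 hκx) (by positivity) ?_
    rw [inv_mul_le_iff₀ hy, mul_one]
    exact le_max_right _ _
  rw [h1, two_mul]
  exact (norm_add_le _ _).trans (add_le_add h2 h3)

end MeanField

/-! ### Invariance of balls under attractive interactions. -/

section Invariance

variable {E : Type*} [NormedAddCommGroup E] [InnerProductSpace ℝ E]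

/-- A curve that does not move outwards outside of a ball centred at the origin does not leave
it. -/
theorem norm_le_of_inner_deriv_nonpos {x x' : ℝ → E} {κ : ℝ}
    (hx : ∀ t, 0 ≤ t → HasDerivWithinAt x (x' t) (Ici 0) t) (h0 : ‖x 0‖ ≤ κ)
    (h : ∀ t, 0 ≤ t → κ < ‖x t‖ → inner ℝ (x t) (x' t) ≤ 0) {t : ℝ} (ht : 0 ≤ t) :
    ‖x t‖ ≤ κ := by
  have hκ : 0 ≤ κ := (norm_nonneg _).trans h0
  -- The growing slack `δ * (1 + t)` makes the comparison strict: where the barrier is touched the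
  -- norm exceeds `κ`, so the derivative is at most `0 < δ`.
  have key : ∀ δ : ℝ, 0 < δ → ‖x t‖ ^ 2 ≤ κ ^ 2 + δ * (1 + t) := by
    intro δ hδ
    have hd : ∀ s, 0 ≤ s → HasDerivWithinAt (fun s => ‖x s‖ ^ 2) (2 * inner ℝ (x s) (x' s))
        (Ici 0) s := fun s hs => (hx s hs).norm_sq
    refine image_le_of_deriv_right_lt_deriv_boundary (f := fun s => ‖x s‖ ^ 2)
      (f' := fun s => 2 * inner ℝ (x s) (x' s)) (a := 0) (b := t)
      (B := fun s => κ ^ 2 + δ * (1 + s)) (B' := fun _ => δ)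
      (fun s hs => (hd s hs.1).continuousWithinAt.mono Icc_subset_Ici_self)
      (fun s hs => (hd s hs.1).mono (Ici_subset_Ici.2 hs.1)) ?_ ?_ ?_ (right_mem_Icc.2 ht)
    · have : ‖x 0‖ ^ 2 ≤ κ ^ 2 := by gcongr
      linarith
    · intro s
      simpa using (((hasDerivAt_id s).const_add 1).const_mul δ).const_add (κ ^ 2)
    · intro s hs hs'
      have h1 : κ < ‖x s‖ := by
        refine lt_of_pow_lt_pow_left₀ 2 (norm_nonneg _) ?_
        have : 0 < δ * (1 + s) := mul_pos hδ (by linarith [hs.1])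
        linarith
      have := h s hs.1 h1
      linarith
  refine (sq_le_sq₀ (norm_nonneg _) hκ).1 ?_
  refine le_of_forall_pos_le_add fun η hη => ?_
  have h1 : 0 < 1 + t := by linarith
  have := key (η / (1 + t)) (by positivity)
  rwa [div_mul_cancel₀ _ h1.ne'] at this

/-- An attractive Lipschitz interaction `F(x, y) = a(x, y) (y - x)` on a ball centred at the origin
generates a global mean-field evolution in the ball. -/
theorem exists_meanField_solution_of_attractive [CompleteSpace E] [SecondCountableTopology E]
    {S : Type*} [TopologicalSpace S] [MeasurableSpace S] [OpensMeasurableSpace S]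
    (μ : Measure S) [IsProbabilityMeasure μ] {a : E → E → ℝ} {κ L : ℝ} (hκ : 0 ≤ κ) (hL : 0 ≤ L)
    (ha : ∀ x y, ‖x‖ ≤ κ → ‖y‖ ≤ κ → 0 ≤ a x y)
    (hF : ∀ x x' y y', ‖x‖ ≤ κ → ‖x'‖ ≤ κ → ‖y‖ ≤ κ → ‖y'‖ ≤ κ →
      ‖a x y • (y - x) - a x' y' • (y' - x')‖ ≤ L * (‖x - x'‖ + ‖y - y'‖))
    (X₀ : S → E) (hX₀ : Continuous X₀) (hX₀κ : ∀ p, ‖X₀ p‖ ≤ κ) :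
    ∃ X : S → ℝ → E, (∀ p, X p 0 = X₀ p) ∧ (∀ t, Continuous fun p => X p t) ∧
      (∀ p t, 0 ≤ t → ‖X p t‖ ≤ κ) ∧
      ∀ p t, 0 ≤ t →
        HasDerivWithinAt (X p) (∫ q, a (X p t) (X q t) • (X q t - X p t) ∂μ) (Ici 0) t := by
  let P : E → E := radialProj κ
  have hP : ∀ x, ‖P x‖ ≤ κ := norm_radialProj_le hκ
  -- Projecting both arguments makes the force globally bounded and Lipschitz without changing it on
  -- the ball.
  let F : E → E → E := fun x y => a (P x) (P y) • (P y - P x)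
  have hF1 : ∀ x x' y y', ‖F x y - F x' y'‖ ≤ (2 * L) * (‖x - x'‖ + ‖y - y'‖) := by
    intro x x' y y'
    refine (hF _ _ _ _ (hP x) (hP x') (hP y) (hP y')).trans ?_
    have h1 : ‖P x - P x'‖ ≤ 2 * ‖x - x'‖ := norm_radialProj_sub_le hκ _ _
    have h2 : ‖P y - P y'‖ ≤ 2 * ‖y - y'‖ := norm_radialProj_sub_le hκ _ _
    nlinarith
  have hF2 : ∀ x y, ‖F x y‖ ≤ L * (κ + κ) := by
    intro x y
    have := hF (P x) 0 (P y) 0 (hP x) (by simpa) (hP y) (by simpa)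
    simp only [sub_zero, smul_zero] at this
    refine this.trans ?_
    gcongr <;> exact hP _
  obtain ⟨X, hX0, hXc, hX⟩ := exists_meanField_solution μ (F := F) (L := ⟨2 * L, by positivity⟩)
    (M := ⟨L * (κ + κ), by positivity⟩) hF1 hF2
    (BoundedContinuousFunction.ofNormedAddCommGroup X₀ hX₀ κ hX₀κ)
  have hFint : ∀ x t, Integrable (fun q => F x (X q t)) μ := by
    intro x t
    have hFx : Continuous (F x) :=
      (LipschitzWith.of_dist_le_mul (K := ⟨2 * L, by positivity⟩) fun y y' => by
        have h := hF1 x x y y'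
        rw [sub_self, norm_zero, zero_add] at h
        rwa [dist_eq_norm, dist_eq_norm]).continuous
    exact Integrable.of_bound (hFx.comp (hXc t)).aestronglyMeasurable _
      (ae_of_all _ fun q => hF2 _ _)
  have hκX : ∀ p t, 0 ≤ t → ‖X p t‖ ≤ κ := by
    intro p t ht
    refine norm_le_of_inner_deriv_nonpos (hX p) ?_ ?_ ht
    · rw [hX0]
      exact hX₀κ p
    · intro s hs hlt
      have h1 : 0 < ‖X p s‖ := hκ.trans_lt hlt
      rw [← integral_inner (hFint _ _)]
      refine integral_nonpos fun q => ?_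
      simp only [F, inner_smul_right, inner_sub_right, Pi.zero_apply]
      refine mul_nonpos_of_nonneg_of_nonpos (ha _ _ (hP _) (hP _)) ?_
      -- Outside the ball, `P x` is the point of the ball that maximises `⟨x, ·⟩`, so attraction
      -- from `P x` to any other point of the ball is not outward.
      have h2 : inner ℝ (X p s) (P (X p s)) = κ * ‖X p s‖ := by
        simp only [P, radialProj, inner_smul_right, max_eq_right hlt.le, real_inner_self_eq_norm_sq]
        field_simp
      have h3 : inner ℝ (X p s) (P (X q s)) ≤ ‖X p s‖ * κ :=
        (real_inner_le_norm _ _).trans (by gcongr; exact hP _)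
      linarith
  refine ⟨X, hX0, hXc, hκX, fun p t ht => ?_⟩
  have h := hX p t ht
  simp only [F, P] at h
  simpa only [radialProj_of_le (hκX _ t ht)] using h

end Invariance

/-! ### The squared angle as a function of the squared half-angle tangent. -/

section Scalar

/-- The analytic function `arctan (√u) / √u`. -/
def arctanDivSqrt (u : ℝ) : ℝ := ∫ s in (0 : ℝ)..1, (1 + u * s ^ 2)⁻¹

/-- The function `(arctan √u)²`. -/
def arctanSqrtSq (u : ℝ) : ℝ := Real.arctan (√u) ^ 2

theorem sqrt_mul_arctanDivSqrt {u : ℝ} (hu : 0 ≤ u) :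
    √u * arctanDivSqrt u = Real.arctan (√u) := by
  have h := intervalIntegral.mul_integral_comp_mul_left (a := 0) (b := 1)
    (f := fun s : ℝ => (1 + s ^ 2)⁻¹) (√u)
  rw [integral_inv_one_add_sq] at h
  simp only [mul_pow, Real.sq_sqrt hu, mul_zero, Real.arctan_zero, sub_zero, mul_one] at h
  exact h

theorem continuous_arctanDivSqrt_integrand {u : ℝ} (hu : 0 ≤ u) :
    Continuous fun s : ℝ => (1 + u * s ^ 2)⁻¹ :=
  Continuous.inv₀ (by fun_prop) fun s => by positivity

theorem arctanDivSqrt_nonneg {u : ℝ} (hu : 0 ≤ u) : 0 ≤ arctanDivSqrt u :=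
  intervalIntegral.integral_nonneg zero_le_one fun s _ => by positivity

theorem arctanDivSqrt_le_one {u : ℝ} (hu : 0 ≤ u) : arctanDivSqrt u ≤ 1 := by
  have h := intervalIntegral.integral_mono_on (μ := volume) (zero_le_one' ℝ)
    ((continuous_arctanDivSqrt_integrand hu).intervalIntegrable 0 1)
    (continuous_const (y := (1 : ℝ)).intervalIntegrable 0 1)
    fun s _ => inv_le_one_of_one_le₀ (by nlinarith [sq_nonneg s] : 1 ≤ 1 + u * s ^ 2)
  simpa [arctanDivSqrt] using h

theorem arctanDivSqrt_zero : arctanDivSqrt 0 = 1 := by simp [arctanDivSqrt]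

theorem abs_arctanDivSqrt_sub_le {u w : ℝ} (hu : 0 ≤ u) (hw : 0 ≤ w) :
    |arctanDivSqrt u - arctanDivSqrt w| ≤ |u - w| := by
  rw [arctanDivSqrt, arctanDivSqrt, ← intervalIntegral.integral_sub
    ((continuous_arctanDivSqrt_integrand hu).intervalIntegrable 0 1)
    ((continuous_arctanDivSqrt_integrand hw).intervalIntegrable 0 1), ← Real.norm_eq_abs]
  refine (intervalIntegral.norm_integral_le_of_norm_le_const (C := |u - w|) fun s hs => ?_).trans
    (by simp)
  rw [uIoc_of_le zero_le_one] at hs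
  have hs2 : s ^ 2 ≤ 1 := pow_le_one₀ hs.1.le hs.2
  have h1 : 1 ≤ 1 + u * s ^ 2 := by nlinarith [sq_nonneg s]
  have h2 : 1 ≤ 1 + w * s ^ 2 := by nlinarith [sq_nonneg s]
  have h3 : (1 + u * s ^ 2)⁻¹ - (1 + w * s ^ 2)⁻¹
      = (w - u) * (s ^ 2 / ((1 + u * s ^ 2) * (1 + w * s ^ 2))) := by
    field_simp
    ring
  rw [h3, norm_mul, Real.norm_eq_abs, Real.norm_of_nonneg (by positivity), abs_sub_comm]
  refine mul_le_of_le_one_right (abs_nonneg _) ((div_le_one (by positivity)).2 ?_)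
  nlinarith

theorem lipschitzOnWith_arctanDivSqrt : LipschitzOnWith 1 arctanDivSqrt (Ici 0) :=
  LipschitzOnWith.of_dist_le_mul fun u hu w hw => by
    simpa [Real.dist_eq] using abs_arctanDivSqrt_sub_le hu hw

theorem arctanSqrtSq_eq {u : ℝ} (hu : 0 ≤ u) : arctanSqrtSq u = u * arctanDivSqrt u ^ 2 := by
  rw [arctanSqrtSq, ← sqrt_mul_arctanDivSqrt hu, mul_pow, Real.sq_sqrt hu]

/-- The square cancels the singularity of `√u` at zero: there the difference quotient is
`arctanDivSqrt w ^ 2`, which tends to 1. This is what handles the squared distance on the diagonal.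
-/
theorem hasDerivWithinAt_arctanSqrtSq {u : ℝ} (hu : 0 ≤ u) :
    HasDerivWithinAt arctanSqrtSq (arctanDivSqrt u / (1 + u)) (Ici 0) u := by
  rcases hu.eq_or_lt with rfl | hu'
  · have hc : ContinuousWithinAt (fun u => arctanDivSqrt u ^ 2) (Ioi 0) 0 :=
      ((lipschitzOnWith_arctanDivSqrt.continuousOn.pow 2) 0 self_mem_Ici).mono Ioi_subset_Ici_self
    rw [← hasDerivWithinAt_Ioi_iff_Ici, hasDerivWithinAt_iff_tendsto_slope' self_notMem_Ioi]
    have h := hc.tendsto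
    simp only [arctanDivSqrt_zero, one_pow] at h
    simp only [arctanDivSqrt_zero, add_zero, div_one]
    refine h.congr' ?_
    filter_upwards [self_mem_nhdsWithin] with w hw
    have hw : 0 < w := hw
    rw [slope_def_field, arctanSqrtSq_eq hw.le, arctanSqrtSq_eq le_rfl]
    rw [zero_mul, sub_zero, sub_zero]
    field_simp
  · have h := ((Real.hasDerivAt_arctan (√u)).comp u (Real.hasDerivAt_sqrt hu'.ne')).pow 2
    refine (h.congr_deriv ?_).hasDerivWithinAt
    have hs : 0 < √u := Real.sqrt_pos.2 hu'
    simp only [Function.comp_apply]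
    rw [Real.sq_sqrt hu, ← sqrt_mul_arctanDivSqrt hu]
    field_simp
    push_cast
    ring

theorem lipschitzOnWith_arctanSqrtSq : LipschitzOnWith 1 arctanSqrtSq (Ici 0) := by
  refine (convex_Ici 0).lipschitzOnWith_of_nnnorm_hasDerivWithin_le
    (fun u hu => hasDerivWithinAt_arctanSqrtSq hu) fun u hu => ?_
  have hu : (0 : ℝ) ≤ u := hu
  rw [← NNReal.coe_le_coe, coe_nnnorm, Real.norm_of_nonneg
    (div_nonneg (arctanDivSqrt_nonneg hu) (by linarith)), NNReal.coe_one,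
    div_le_one (by linarith)]
  linarith [arctanDivSqrt_le_one hu]

theorem arccos_eq_two_mul_arctan_sqrt {c : ℝ} (h : -1 < c) (h' : c ≤ 1) :
    Real.arccos c = 2 * Real.arctan (√((1 - c) / (1 + c))) := by
  have h1 : 0 < 1 + c := by linarith
  have h0 : 0 ≤ (1 - c) / (1 + c) := div_nonneg (by linarith) h1.le
  have hc : c = Real.cos (2 * Real.arctan (√((1 - c) / (1 + c)))) := by
    rw [Real.cos_two_mul, Real.cos_sq_arctan, Real.sq_sqrt h0]
    field_simp
    ring
  conv_lhs => rw [hc]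
  refine Real.arccos_cos ?_ ?_
  · have := Real.arctan_nonneg.2 (Real.sqrt_nonneg ((1 - c) / (1 + c)))
    linarith
  · linarith [Real.arctan_lt_pi_div_two (√((1 - c) / (1 + c)))]

end Scalar

/-! ### The Rodrigues chart of the rotation group. -/

section Chart

/-- The three-dimensional Euclidean space. -/
abbrev E3 : Type := EuclideanSpace ℝ (Fin 3)

theorem norm_sq_E3 (x : E3) : ‖x‖ ^ 2 = x 0 ^ 2 + x 1 ^ 2 + x 2 ^ 2 := by
  simp [EuclideanSpace.norm_sq_eq, Fin.sum_univ_three]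

theorem inner_E3 (x y : E3) : inner ℝ x y = x 0 * y 0 + x 1 * y 1 + x 2 * y 2 := by
  simp [PiLp.inner_apply, Fin.sum_univ_three, mul_comm]

theorem one_add_norm_sq_pos (x : E3) : 0 < 1 + ‖x‖ ^ 2 := by positivity

/-- The numerator of `rotMat`. -/
def rotNum (x : E3) : Matrix (Fin 3) (Fin 3) ℝ :=
  !![1 + x 0 ^ 2 - x 1 ^ 2 - x 2 ^ 2, 2 * (x 0 * x 1 - x 2), 2 * (x 0 * x 2 + x 1);
    2 * (x 0 * x 1 + x 2), 1 - x 0 ^ 2 + x 1 ^ 2 - x 2 ^ 2, 2 * (x 1 * x 2 - x 0);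
    2 * (x 0 * x 2 - x 1), 2 * (x 1 * x 2 + x 0), 1 - x 0 ^ 2 - x 1 ^ 2 + x 2 ^ 2]

/-- The matrix of the rotation with Rodrigues vector `x`, that is, with axis `x` and angle
`2 arctan ‖x‖`. -/
def rotMat (x : E3) : Matrix (Fin 3) (Fin 3) ℝ := (1 + ‖x‖ ^ 2)⁻¹ • rotNum x

theorem rotNum_mul_transpose (x : E3) :
    rotNum x * (rotNum x)ᵀ = (1 + ‖x‖ ^ 2) ^ 2 • (1 : Matrix (Fin 3) (Fin 3) ℝ) := by
  rw [norm_sq_E3]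
  ext a b
  fin_cases a <;> fin_cases b <;>
    simp [rotNum, Matrix.mul_apply, Fin.sum_univ_three] <;> ring

theorem det_rotNum (x : E3) : (rotNum x).det = (1 + ‖x‖ ^ 2) ^ 3 := by
  rw [norm_sq_E3, Matrix.det_fin_three]
  simp [rotNum]
  ring

theorem rotMat_mem (x : E3) : rotMat x ∈ Matrix.specialOrthogonalGroup (Fin 3) ℝ := by
  have h := one_add_norm_sq_pos x
  rw [Matrix.mem_specialOrthogonalGroup_iff, Matrix.mem_orthogonalGroup_iff]
  constructor
  · change rotMat x * (rotMat x)ᵀ = 1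
    rw [rotMat, Matrix.transpose_smul, Matrix.smul_mul, Matrix.mul_smul, rotNum_mul_transpose,
      smul_smul, smul_smul]
    convert one_smul ℝ _
    field_simp
  · rw [rotMat, Matrix.det_smul, det_rotNum]
    simp
    field_simp

/-- The rotation with Rodrigues vector `x`. -/
def rot (x : E3) : SO3 := ⟨rotMat x, rotMat_mem x⟩

theorem mat_rot (x : E3) : mat (rot x) = rotMat x := rfl

theorem mat_injective : Function.Injective mat := Subtype.val_injective

theorem mat_mul (R Q : SO3) : mat (R * Q) = mat R * mat Q := rfl

theorem mat_mul_transpose (R : SO3) : mat R * (mat R)ᵀ = 1 :=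
  (Matrix.mem_orthogonalGroup_iff _ _).1 (Matrix.mem_specialOrthogonalGroup_iff.1 R.2).1

theorem transpose_mul_mat (R : SO3) : (mat R)ᵀ * mat R = 1 :=
  mul_eq_one_comm.1 (mat_mul_transpose R)

theorem det_mat (R : SO3) : (mat R).det = 1 := (Matrix.mem_specialOrthogonalGroup_iff.1 R.2).2

theorem continuous_mat : Continuous mat := continuous_subtype_val

theorem rot_zero : rot 0 = 1 := by
  apply mat_injective
  change rotMat 0 = 1
  ext a b
  fin_cases a <;> fin_cases b <;> simp [rotMat, rotNum]

/-- The Rodrigues vector of a rotation by an angle less than `π`. -/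
def rodrigues (R : SO3) : E3 :=
  (1 + (mat R).trace)⁻¹ •
    !₂[mat R 2 1 - mat R 1 2, mat R 0 2 - mat R 2 0, mat R 1 0 - mat R 0 1]

theorem trace_rotMat (x : E3) : 1 + (rotMat x).trace = 4 * (1 + ‖x‖ ^ 2)⁻¹ := by
  have h := one_add_norm_sq_pos x
  have h2 : (rotNum x).trace = 3 - ‖x‖ ^ 2 := by
    rw [norm_sq_E3, Matrix.trace_fin_three]
    simp [rotNum]
    ring
  rw [rotMat, Matrix.trace_smul, h2, smul_eq_mul]
  field_simp
  ring

theorem rodrigues_rot (x : E3) : rodrigues (rot x) = x := by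
  have h := one_add_norm_sq_pos x
  rw [rodrigues, mat_rot, trace_rotMat]
  ext i
  fin_cases i <;> simp [rotMat, rotNum] <;> field_simp <;> ring

theorem cofactor_eq (R : SO3) : (mat R).adjugate = (mat R)ᵀ := by
  have h := Matrix.adjugate_mul (mat R)
  rw [det_mat, one_smul] at h
  calc (mat R).adjugate = (mat R).adjugate * (mat R * (mat R)ᵀ) := by
        rw [mat_mul_transpose, mul_one]
    _ = (mat R)ᵀ := by rw [← mul_assoc, h, one_mul]

/-- These say that the unnormalised quaternion with real part `1 + tr R` and imaginary part read off
the skew part reproduces `R`. They are combinations of the row and column orthonormality relations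
and of the equality of each entry with its cofactor. -/
theorem rodrigues_relations (R : SO3) :
    ((1 + (mat R).trace) ^ 2 + (mat R 2 1 - mat R 1 2) ^ 2 - (mat R 0 2 - mat R 2 0) ^ 2
        - (mat R 1 0 - mat R 0 1) ^ 2 = 4 * (1 + (mat R).trace) * mat R 0 0 ∧
      (1 + (mat R).trace) ^ 2 - (mat R 2 1 - mat R 1 2) ^ 2 + (mat R 0 2 - mat R 2 0) ^ 2
        - (mat R 1 0 - mat R 0 1) ^ 2 = 4 * (1 + (mat R).trace) * mat R 1 1 ∧
      (1 + (mat R).trace) ^ 2 - (mat R 2 1 - mat R 1 2) ^ 2 - (mat R 0 2 - mat R 2 0) ^ 2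
        + (mat R 1 0 - mat R 0 1) ^ 2 = 4 * (1 + (mat R).trace) * mat R 2 2) ∧
    (mat R 2 1 - mat R 1 2) * (mat R 0 2 - mat R 2 0)
        = (1 + (mat R).trace) * (mat R 0 1 + mat R 1 0) ∧
      (mat R 0 2 - mat R 2 0) * (mat R 1 0 - mat R 0 1)
        = (1 + (mat R).trace) * (mat R 1 2 + mat R 2 1) ∧
      (mat R 1 0 - mat R 0 1) * (mat R 2 1 - mat R 1 2)
        = (1 + (mat R).trace) * (mat R 0 2 + mat R 2 0) := by
  have hr := fun i j => congrFun (congrFun (mat_mul_transpose R) i) j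
  have hc := fun i j => congrFun (congrFun (transpose_mul_mat R) i) j
  have ha := fun i j => congrFun (congrFun (cofactor_eq R) i) j
  simp only [Matrix.adjugate_fin_three] at ha
  have r00 := hr 0 0
  have r11 := hr 1 1
  have r22 := hr 2 2
  have r01 := hr 0 1
  have r02 := hr 0 2
  have r12 := hr 1 2
  have c00 := hc 0 0
  have c11 := hc 1 1
  have c22 := hc 2 2
  have c01 := hc 0 1
  have c02 := hc 0 2
  have c12 := hc 1 2
  have a00 := ha 0 0
  have a11 := ha 1 1
  have a22 := ha 2 2
  have a01 := ha 0 1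
  have a10 := ha 1 0
  have a02 := ha 0 2
  have a20 := ha 2 0
  have a12 := ha 1 2
  have a21 := ha 2 1
  simp [Matrix.mul_apply, Fin.sum_univ_three] at r00 r11 r22 r01 r02 r12 c00 c11 c22 c01 c02 c12
  simp at a00 a11 a22 a01 a10 a02 a20 a12 a21
  rw [Matrix.trace_fin_three]
  refine ⟨⟨?_, ?_, ?_⟩, ?_, ?_, ?_⟩
  · linear_combination r11 + r22 - c00 - r00 - c00 + 2 * a00 - 2 * a11 - 2 * a22
  · linear_combination r00 + r22 - c11 - r11 - c11 + 2 * a11 - 2 * a00 - 2 * a22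
  · linear_combination r00 + r11 - c22 - r22 - c22 + 2 * a22 - 2 * a00 - 2 * a11
  · linear_combination a10 + a01 - c01 - r01
  · linear_combination a12 + a21 - c12 - r12
  · linear_combination a20 + a02 - c02 - r02

theorem rot_rodrigues {R : SO3} (hR : 0 < 1 + (mat R).trace) : rot (rodrigues R) = R := by
  obtain ⟨⟨h0, h1, h2⟩, h3, h4, h5⟩ := rodrigues_relations R
  set τ := 1 + (mat R).trace with hτ
  have htr : mat R 0 0 + mat R 1 1 + mat R 2 2 = τ - 1 := by
    rw [hτ, Matrix.trace_fin_three]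
    ring
  have hn : 1 + ‖rodrigues R‖ ^ 2 = 4 * τ⁻¹ := by
    rw [norm_sq_E3]
    simp [rodrigues, ← hτ]
    field_simp
    linear_combination -4 * τ * htr - h0 - h1 - h2
  apply mat_injective
  rw [mat_rot, rotMat, hn]
  ext i j
  fin_cases i <;> fin_cases j <;> simp [rotNum, rodrigues, ← hτ] <;> field_simp <;> linarith

end Chart

/-! ### Geodesic distance in Rodrigues coordinates. -/

section Distance

/-- The cosine of the geodesic distance. -/
def cosDist (R Q : SO3) : ℝ := (((mat R)ᵀ * mat Q).trace - 1) / 2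

/-- The squared Frobenius distance of the two matrices is `4 * (1 - cosDist R Q)`. -/
theorem cosDist_le_one (R Q : SO3) : cosDist R Q ≤ 1 := by
  have h1 := congrArg Matrix.trace (transpose_mul_mat R)
  have h2 := congrArg Matrix.trace (transpose_mul_mat Q)
  have h3 : 0 ≤ ∑ i, ∑ j, (mat R i j - mat Q i j) ^ 2 := by positivity
  rw [cosDist]
  simp only [Matrix.trace_fin_three, Matrix.mul_apply, Fin.sum_univ_three,
    Matrix.transpose_apply, Matrix.one_apply_eq] at h1 h2 h3 ⊢
  linarith

theorem dist_eq_two_mul_arctan {R Q : SO3} (h : -1 < cosDist R Q) :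
    dist R Q = 2 * Real.arctan (√((1 - cosDist R Q) / (1 + cosDist R Q))) :=
  arccos_eq_two_mul_arctan_sqrt h (cosDist_le_one R Q)

theorem dist_sq_eq {R Q : SO3} (h : -1 < cosDist R Q) :
    dist R Q ^ 2 = 4 * arctanSqrtSq ((1 - cosDist R Q) / (1 + cosDist R Q)) := by
  rw [dist_eq_two_mul_arctan h, arctanSqrtSq]
  ring

/-- The squared tangent of half the angle between the rotations with Rodrigues vectors `x`
and `y`. -/
def tanHalfSq (x y : E3) : ℝ := (1 + ‖x‖ ^ 2) * (1 + ‖y‖ ^ 2) / (1 + inner ℝ x y) ^ 2 - 1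

/-- This is Cauchy–Schwarz for the quaternions `(1, x)` and `(1, y)`. -/
theorem tanHalfSq_nonneg {x y : E3} (h : 0 < 1 + inner ℝ x y) : 0 ≤ tanHalfSq x y := by
  rw [tanHalfSq, sub_nonneg, one_le_div (by positivity)]
  have h1 := real_inner_le_norm x y
  have h2 := real_inner_mul_inner_self_le x y
  rw [real_inner_self_eq_norm_sq, real_inner_self_eq_norm_sq] at h2
  nlinarith [sq_nonneg (‖x‖ - ‖y‖)]

theorem trace_rotNum (x y : E3) : ((rotNum x)ᵀ * rotNum y).trace =
    4 * (1 + inner ℝ x y) ^ 2 - (1 + ‖x‖ ^ 2) * (1 + ‖y‖ ^ 2) := by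
  rw [norm_sq_E3, norm_sq_E3, inner_E3, Matrix.trace_fin_three]
  simp [Matrix.mul_apply, Fin.sum_univ_three, rotNum]
  ring

/-- Half the angle between the rotations has cosine `±(1 + ⟨x, y⟩) / (‖(1, x)‖ ‖(1, y)‖)`, and `1 +
cos θ = 2 cos²(θ/2)`. -/
theorem one_add_cosDist_rot (x y : E3) : 1 + cosDist (rot x) (rot y) =
    2 * (1 + inner ℝ x y) ^ 2 / ((1 + ‖x‖ ^ 2) * (1 + ‖y‖ ^ 2)) := by
  have hx := one_add_norm_sq_pos x
  have hy := one_add_norm_sq_pos y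
  rw [cosDist, mat_rot, mat_rot, rotMat, rotMat, Matrix.transpose_smul, Matrix.smul_mul,
    Matrix.mul_smul, Matrix.trace_smul, Matrix.trace_smul, trace_rotNum, smul_eq_mul, smul_eq_mul]
  field_simp
  ring

theorem neg_one_lt_cosDist_rot {x y : E3} (h : 0 < 1 + inner ℝ x y) :
    -1 < cosDist (rot x) (rot y) := by
  have h1 := one_add_cosDist_rot x y
  have : 0 < 1 + cosDist (rot x) (rot y) := by
    rw [h1]
    positivity
  linarith

theorem tanHalfSq_eq {x y : E3} (h : 0 < 1 + inner ℝ x y) :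
    (1 - cosDist (rot x) (rot y)) / (1 + cosDist (rot x) (rot y)) = tanHalfSq x y := by
  have hx := one_add_norm_sq_pos x
  have hy := one_add_norm_sq_pos y
  have h1 := one_add_cosDist_rot x y
  have h2 : 1 - cosDist (rot x) (rot y) = 2 - (1 + cosDist (rot x) (rot y)) := by ring
  rw [h2, h1, tanHalfSq]
  field_simp

theorem dist_one_rot (x : E3) : dist 1 (rot x) = 2 * Real.arctan ‖x‖ := by
  have h : (0 : ℝ) < 1 + inner ℝ (0 : E3) x := by simp
  rw [← rot_zero, dist_eq_two_mul_arctan (neg_one_lt_cosDist_rot h), tanHalfSq_eq h, tanHalfSq]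
  simp

theorem one_add_trace_pos {R : SO3} (h : dist 1 R < Real.pi / 2) : 0 < 1 + (mat R).trace := by
  rw [dist, Real.arccos_lt_pi_div_two] at h
  have h1 : (mat (1 : SO3))ᵀ * mat R = mat R := by
    change (1 : Matrix (Fin 3) (Fin 3) ℝ)ᵀ * mat R = mat R
    rw [Matrix.transpose_one, one_mul]
  rw [h1] at h
  linarith

theorem dist_one_eq {R : SO3} (h : dist 1 R < Real.pi / 2) :
    dist 1 R = 2 * Real.arctan ‖rodrigues R‖ := by
  conv_lhs => rw [← rot_rodrigues (one_add_trace_pos h), dist_one_rot]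

theorem continuous_dist_one : Continuous fun R : SO3 => dist 1 R := by
  refine Real.continuous_arccos.comp ?_
  have := continuous_mat
  fun_prop

end Distance

/-! ### Derivatives of the potential along the coordinate geodesics. -/

section Gradient

theorem mat_axisRot (i : Fin 3) (s : ℝ) : mat (axisRot i s) =
    1 + Real.sin s • basisSkew i + (1 - Real.cos s) • basisSkew i ^ 2 := rfl

theorem axisRot_zero (i : Fin 3) : axisRot i 0 = 1 := by
  apply mat_injective
  rw [mat_axisRot]
  simp
  rfl

theorem hasDerivAt_cosDist (R Q : SO3) (i : Fin 3) :
    HasDerivAt (fun s => cosDist (R * axisRot i s) Q)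
      (((mat R * basisSkew i)ᵀ * mat Q).trace / 2) 0 := by
  have h : ∀ s, cosDist (R * axisRot i s) Q = (((mat R)ᵀ * mat Q).trace
      + Real.sin s * ((mat R * basisSkew i)ᵀ * mat Q).trace
      + (1 - Real.cos s) * ((mat R * basisSkew i ^ 2)ᵀ * mat Q).trace - 1) / 2 := by
    intro s
    rw [cosDist, mat_mul, mat_axisRot, mul_add, mul_add, mul_one, Matrix.transpose_add,
      Matrix.transpose_add, add_mul, add_mul, Matrix.mul_smul, Matrix.mul_smul,
      Matrix.transpose_smul, Matrix.transpose_smul, Matrix.smul_mul, Matrix.smul_mul,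
      Matrix.trace_add, Matrix.trace_add, Matrix.trace_smul, Matrix.trace_smul, smul_eq_mul,
      smul_eq_mul]
  simp only [h]
  have h1 := (((((Real.hasDerivAt_sin 0).mul_const ((mat R * basisSkew i)ᵀ * mat Q).trace).const_add
    ((mat R)ᵀ * mat Q).trace).add (((Real.hasDerivAt_cos 0).const_sub 1).mul_const
    ((mat R * basisSkew i ^ 2)ᵀ * mat Q).trace)).sub_const 1).div_const 2
  refine h1.congr_deriv ?_
  simp

/-- The chain rule passes through `u = tan²(θ/2)` instead of `arccos`, which is singular at `R = Q`.
One-sided derivatives in `u` and of `g` suffice because `u` never becomes negative. -/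
theorem hasDerivAt_comp_dist_sq {g : ℝ → ℝ} (hg : DifferentiableOn ℝ g (Ici 0)) {R Q : SO3}
    (h : -1 < cosDist R Q) (i : Fin 3) {u : ℝ}
    (hu : (1 - cosDist R Q) / (1 + cosDist R Q) = u) :
    HasDerivAt (fun s => g (dist (R * axisRot i s) Q ^ 2))
      (-(derivWithin g (Ici 0) (4 * arctanSqrtSq u) * arctanDivSqrt u * (1 + u) *
        ((mat R * basisSkew i)ᵀ * mat Q).trace)) 0 := by
  have hR : R * axisRot i 0 = R := by rw [axisRot_zero, mul_one]
  set τ := ((mat R * basisSkew i)ᵀ * mat Q).trace with hτ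
  have h1 : 0 < 1 + cosDist R Q := by linarith
  have hu0 : 0 ≤ u := hu ▸ div_nonneg (by linarith [cosDist_le_one R Q]) h1.le
  have hcu : 1 + u = 2 / (1 + cosDist R Q) := by
    rw [← hu]
    field_simp
    ring
  have hc := hasDerivAt_cosDist R Q i
  rw [← hτ] at hc
  have hq : HasDerivAt (fun s => (1 - cosDist (R * axisRot i s) Q)
      / (1 + cosDist (R * axisRot i s) Q)) (-((1 + u) ^ 2 / 4 * τ)) 0 := by
    have h2 := (hc.const_sub 1).div (hc.const_add 1) (by rw [hR]; exact h1.ne')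
    refine h2.congr_deriv ?_
    rw [hR, hcu]
    field_simp
    ring
  have hnear : ∀ᶠ s in 𝓝 (0 : ℝ), -1 < cosDist (R * axisRot i s) Q := by
    refine hc.continuousAt.eventually (lt_mem_nhds ?_)
    simpa only [hR] using h
  have hmem : ∀ᶠ s in 𝓝 (0 : ℝ), (1 - cosDist (R * axisRot i s) Q)
      / (1 + cosDist (R * axisRot i s) Q) ∈ Ici (0 : ℝ) := by
    filter_upwards [hnear] with s hs
    have hs' := cosDist_le_one (R * axisRot i s) Q
    exact mem_Ici.2 (div_nonneg (sub_nonneg.2 hs') (neg_le_iff_add_nonneg'.1 hs.le))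
  have hT := (hasDerivWithinAt_arctanSqrtSq hu0).const_mul 4
  have h4 : 0 ≤ 4 * arctanSqrtSq u := mul_nonneg (by norm_num) (sq_nonneg _)
  have hgT := ((hg _ h4).hasDerivWithinAt).comp u hT
    (fun w _ => mul_nonneg (by norm_num) (sq_nonneg _))
  have hfin := hgT.comp_hasDerivAt_of_eq (0 : ℝ) hq hmem (by rw [hR, hu])
  refine (hfin.congr_deriv ?_).congr_of_eventuallyEq ?_
  · have : 1 + u ≠ 0 := by positivity
    field_simp
  · filter_upwards [hnear] with s hs
    simp only [Function.comp_apply, dist_sq_eq hs]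

end Gradient

/-! ### The gradient field in the chart. -/

section RotDeriv

/-- The vector `z - x × z`. -/
def bodyVec (x z : E3) : Fin 3 → ℝ :=
  ![z 0 - (x 1 * z 2 - x 2 * z 1), z 1 - (x 2 * z 0 - x 0 * z 2), z 2 - (x 0 * z 1 - x 1 * z 0)]

/-- `rotMat`, with values in a normed space. -/
def rotFun (x : E3) : Fin 3 → Fin 3 → ℝ := fun i j => rotMat x i j

theorem rotFun_apply (x : E3) (i j : Fin 3) :
    rotFun x i j = (1 + ‖x‖ ^ 2)⁻¹ * rotNum x i j := rfl

theorem differentiable_rotFun : Differentiable ℝ rotFun := by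
  have hn : ∀ i j, Differentiable ℝ fun x : E3 => rotNum x i j := by
    intro i j
    fin_cases i <;> fin_cases j <;> simp [rotNum] <;> fun_prop
  refine differentiable_pi.2 fun i => differentiable_pi.2 fun j => ?_
  simp only [rotFun_apply]
  refine Differentiable.mul (Differentiable.inv ?_ fun x => (one_add_norm_sq_pos x).ne') (hn i j)
  exact (differentiable_id.norm_sq ℝ).const_add 1

theorem hasDerivAt_quotient_quadratic (a b c n p q : ℝ) (hn : n ≠ 0) :
    HasDerivAt (fun t : ℝ => (n + t * p + t ^ 2 * q)⁻¹ * (a + t * b + t ^ 2 * c))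
      ((n * b - p * a) / n ^ 2) 0 := by
  have h : ∀ a b c : ℝ, HasDerivAt (fun t : ℝ => a + t * b + t ^ 2 * c) b 0 := by
    intro a b c
    have := (((hasDerivAt_id (0 : ℝ)).mul_const b).const_add a).add
      (((hasDerivAt_id (0 : ℝ)).pow 2).mul_const c)
    simpa using! this
  have h1 := ((h n p q).inv (by simpa using hn)).mul (h a b c)
  refine h1.congr_deriv ?_
  simp
  field_simp
  ring

theorem fderiv_rotFun (x z : E3) (i j : Fin 3) :
    fderiv ℝ rotFun x z i j = 2 / (1 + ‖x‖ ^ 2) * (rotMat x * hat (bodyVec x z)) i j := by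
  have hl : HasDerivAt (fun t : ℝ => x + t • z) z 0 := by
    simpa using ((hasDerivAt_id (0 : ℝ)).smul_const z).const_add x
  have hf : HasFDerivAt rotFun (fderiv ℝ rotFun x) (x + (0 : ℝ) • z) := by
    rw [zero_smul, add_zero]
    exact (differentiable_rotFun x).hasFDerivAt
  have h1 := hasDerivAt_pi.1 (hasDerivAt_pi.1 (hf.comp_hasDerivAt 0 hl) i) j
  have hN : ∀ t : ℝ, 1 + ‖x + t • z‖ ^ 2
      = (1 + ‖x‖ ^ 2) + t * (2 * inner ℝ x z) + t ^ 2 * ‖z‖ ^ 2 := by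
    intro t
    rw [norm_add_sq_real, inner_smul_right, norm_smul, mul_pow, Real.norm_eq_abs, sq_abs]
    ring
  have hexp : ∃ b c : ℝ, (∀ t : ℝ, rotNum (x + t • z) i j = rotNum x i j + t * b + t ^ 2 * c) ∧
      (1 + ‖x‖ ^ 2) * b - 2 * inner ℝ x z * rotNum x i j
        = 2 * (rotNum x * hat (bodyVec x z)) i j := by
    -- Each entry is quadratic along the line, so its values at `t = -1, 0, 1` determine the
    -- coefficients.
    refine ⟨(rotNum (x + z) i j - rotNum (x - z) i j) / 2,
      (rotNum (x + z) i j + rotNum (x - z) i j) / 2 - rotNum x i j, ?_, ?_⟩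
    · intro t
      fin_cases i <;> fin_cases j <;> simp [rotNum] <;> ring
    · rw [norm_sq_E3, inner_E3]
      fin_cases i <;> fin_cases j <;>
        simp [rotNum, Matrix.mul_apply, Fin.sum_univ_three, hat, bodyVec] <;> ring
  obtain ⟨b, c, hbc, hid⟩ := hexp
  have hn := one_add_norm_sq_pos x
  have h2 := hasDerivAt_quotient_quadratic (rotNum x i j) b c (1 + ‖x‖ ^ 2) (2 * inner ℝ x z)
    (‖z‖ ^ 2) hn.ne'
  have h3 : HasDerivAt (fun t : ℝ => rotFun (x + t • z) i j) (fderiv ℝ rotFun x z i j) 0 := h1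
  simp only [rotFun_apply, hN, hbc] at h3
  rw [h3.unique h2, hid, rotMat, Matrix.smul_mul, Matrix.smul_apply, smul_eq_mul]
  field_simp

theorem trace_basisSkew_rot (x y : E3) (k : Fin 3) :
    ((mat (rot x) * basisSkew k)ᵀ * mat (rot y)).trace
      = 4 * (1 + inner ℝ x y) / ((1 + ‖x‖ ^ 2) * (1 + ‖y‖ ^ 2)) * bodyVec x (y - x) k := by
  have hx := one_add_norm_sq_pos x
  have hy := one_add_norm_sq_pos y
  have h : ((rotNum x * basisSkew k)ᵀ * rotNum y).trace
      = 4 * (1 + inner ℝ x y) * bodyVec x (y - x) k := by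
    rw [inner_E3, Matrix.trace_fin_three]
    fin_cases k <;>
      simp [Matrix.mul_apply, Fin.sum_univ_three, rotNum, basisSkew, hat, bodyVec] <;> ring
  rw [mat_rot, mat_rot, rotMat, rotMat, Matrix.smul_mul, Matrix.transpose_smul, Matrix.smul_mul,
    Matrix.mul_smul, Matrix.trace_smul, Matrix.trace_smul, h, smul_eq_mul, smul_eq_mul]
  field_simp

theorem sum_smul_basisSkew (v : Fin 3 → ℝ) : ∑ k, v k • basisSkew k = hat v := by
  ext i j
  fin_cases i <;> fin_cases j <;> simp [Fin.sum_univ_three, basisSkew, hat]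

/-- The strength of the interaction in Rodrigues coordinates. -/
def strength (g : ℝ → ℝ) (x y : E3) : ℝ :=
  2 * derivWithin g (Ici 0) (4 * arctanSqrtSq (tanHalfSq x y)) * arctanDivSqrt (tanHalfSq x y) *
    ((1 + ‖x‖ ^ 2) / (1 + inner ℝ x y))

/-- The traces with the frame give `bodyVec x (y - x)`, the same vector that `fderiv_rotFun` assigns
to the chart direction `y - x`: in the chart the gradient lies along the segment to `y`. -/
theorem grad_rot {K : SO3 → SO3 → ℝ} {g : ℝ → ℝ} (hK : ∀ R Q, K R Q = g (dist R Q ^ 2))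
    (hg : DifferentiableOn ℝ g (Ici 0)) {x y : E3} (h : 0 < 1 + inner ℝ x y) (i j : Fin 3) :
    grad (fun S => K S (rot y)) (rot x) i j
      = -fderiv ℝ rotFun x (strength g x y • (y - x)) i j := by
  have hx := one_add_norm_sq_pos x
  have hy := one_add_norm_sq_pos y
  have hd := fun k => (hasDerivAt_comp_dist_sq hg (neg_one_lt_cosDist_rot h) k
    (tanHalfSq_eq h)).deriv
  set c := derivWithin g (Ici 0) (4 * arctanSqrtSq (tanHalfSq x y)) * arctanDivSqrt (tanHalfSq x y)
    with hc
  have hu : 1 + tanHalfSq x y = (1 + ‖x‖ ^ 2) * (1 + ‖y‖ ^ 2) / (1 + inner ℝ x y) ^ 2 := by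
    rw [tanHalfSq]
    ring
  have hgrad : grad (fun S => K S (rot y)) (rot x)
      = -(4 * c / (1 + inner ℝ x y)) • (rotMat x * hat (bodyVec x (y - x))) := by
    rw [← sum_smul_basisSkew, Matrix.mul_sum, Finset.smul_sum]
    simp only [grad, hK]
    refine Finset.sum_congr rfl fun k _ => ?_
    rw [hd, trace_basisSkew_rot, hu, Matrix.mul_smul, smul_smul, mat_rot]
    congr 1
    field_simp
  rw [hgrad, map_smul, Pi.smul_apply, Pi.smul_apply, fderiv_rotFun, Matrix.smul_apply, smul_eq_mul,
    smul_eq_mul, strength, mul_assoc 2, ← hc]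
  field_simp
  ring

end RotDeriv

/-! ### Lipschitz continuity of the force on balls of radius below one. -/

section Lipschitz

theorem exists_lipschitzOnWith_smul {α F : Type*} [PseudoMetricSpace α] [NormedAddCommGroup F]
    [NormedSpace ℝ F] {s : Set α} (hs : IsCompact s) {f : α → ℝ} {h : α → F}
    (hf : ∃ C, LipschitzOnWith C f s) (hh : ∃ C, LipschitzOnWith C h s) :
    ∃ C, LipschitzOnWith C (fun x => f x • h x) s := by
  obtain ⟨A, hA⟩ := hf
  obtain ⟨B, hB⟩ := hh
  obtain ⟨a, ha⟩ := hs.exists_bound_of_continuousOn hA.continuousOn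
  obtain ⟨b, hb⟩ := hs.exists_bound_of_continuousOn hB.continuousOn
  refine ⟨a.toNNReal * B + A * b.toNNReal, LipschitzOnWith.of_dist_le_mul fun x hx y hy => ?_⟩
  have h1 := hA.dist_le_mul x hx y hy
  have h2 := hB.dist_le_mul x hx y hy
  rw [dist_eq_norm] at h1 h2
  have h3 : f x • h x - f y • h y = f x • (h x - h y) + (f x - f y) • h y := by module
  rw [dist_eq_norm, h3]
  refine (norm_add_le _ _).trans ?_
  rw [norm_smul, norm_smul]
  push_cast
  rw [add_mul]
  refine add_le_add ?_ ?_
  · rw [mul_assoc]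
    gcongr
    exact (ha x hx).trans (Real.le_coe_toNNReal a)
  · rw [mul_right_comm]
    gcongr
    exact (hb y hy).trans (Real.le_coe_toNNReal b)

theorem exists_lipschitzOnWith_of_contDiffAt {F G : Type*} [NormedAddCommGroup F]
    [NormedSpace ℝ F] [NormedAddCommGroup G] [NormedSpace ℝ G] {s : Set F} (hs : IsCompact s)
    {f : F → G} (hf : ∀ x ∈ s, ContDiffAt ℝ 1 f x) : ∃ C, LipschitzOnWith C f s := by
  refine LocallyLipschitzOn.exists_lipschitzOnWith_of_compact hs fun x hx => ?_
  obtain ⟨C, t, ht, hC⟩ := (hf x hx).exists_lipschitzOnWith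
  exact ⟨C, t, mem_nhdsWithin_of_mem_nhds ht, hC⟩

theorem one_add_inner_pos {κ : ℝ} (hκ : κ < 1) {x y : E3} (hx : ‖x‖ ≤ κ) (hy : ‖y‖ ≤ κ) :
    0 < 1 + inner ℝ x y := by
  have h1 := abs_real_inner_le_norm x y
  have h2 := neg_abs_le (inner ℝ x y)
  nlinarith [norm_nonneg x, norm_nonneg y]

theorem strength_nonneg {g : ℝ → ℝ} (hpos : ∀ s, 0 ≤ s → 0 ≤ derivWithin g (Ici 0) s) {x y : E3}
    (h : 0 < 1 + inner ℝ x y) : 0 ≤ strength g x y := by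
  have h1 := hpos (4 * arctanSqrtSq (tanHalfSq x y)) (mul_nonneg (by norm_num) (sq_nonneg _))
  have h2 := arctanDivSqrt_nonneg (tanHalfSq_nonneg h)
  have h3 := one_add_norm_sq_pos x
  rw [strength]
  positivity

/-- The interaction in Rodrigues coordinates. -/
def force (g : ℝ → ℝ) (x y : E3) : E3 := strength g x y • (y - x)

theorem exists_force_lipschitz {g : ℝ → ℝ}
    (hg' : LocallyLipschitzOn (Ici 0) (derivWithin g (Ici 0))) {κ : ℝ} (hκ : κ < 1) :
    ∃ L : ℝ≥0, ∀ x x' y y', ‖x‖ ≤ κ → ‖x'‖ ≤ κ → ‖y‖ ≤ κ → ‖y'‖ ≤ κ →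
      ‖force g x y - force g x' y'‖ ≤ L * (‖x - x'‖ + ‖y - y'‖) := by
  set s : Set (E3 × E3) := closedBall 0 κ ×ˢ closedBall 0 κ with hs_def
  have hs : IsCompact s := (isCompact_closedBall _ _).prod (isCompact_closedBall _ _)
  have hpos : ∀ p ∈ s, 0 < 1 + inner ℝ p.1 p.2 := fun p hp =>
    one_add_inner_pos hκ (mem_closedBall_zero_iff.1 hp.1) (mem_closedBall_zero_iff.1 hp.2)
  have hinner : ContDiff ℝ 1 fun p : E3 × E3 => 1 + inner ℝ p.1 p.2 :=
    contDiff_const.add (contDiff_fst.inner ℝ contDiff_snd)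
  have hn1 : ContDiff ℝ 1 fun p : E3 × E3 => 1 + ‖p.1‖ ^ 2 :=
    contDiff_const.add (contDiff_fst.norm_sq ℝ)
  have hn2 : ContDiff ℝ 1 fun p : E3 × E3 => 1 + ‖p.2‖ ^ 2 :=
    contDiff_const.add (contDiff_snd.norm_sq ℝ)
  have ht : ∃ C, LipschitzOnWith C (fun p : E3 × E3 => tanHalfSq p.1 p.2) s := by
    refine exists_lipschitzOnWith_of_contDiffAt hs fun p hp => ?_
    exact ((hn1.mul hn2).contDiffAt.div (hinner.pow 2).contDiffAt
      (pow_ne_zero 2 (hpos p hp).ne')).sub contDiffAt_const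
  have hmaps : MapsTo (fun p : E3 × E3 => tanHalfSq p.1 p.2) s (Ici 0) := fun p hp =>
    tanHalfSq_nonneg (hpos p hp)
  have h1 : ∃ C, LipschitzOnWith C (fun p : E3 × E3 => (1 + ‖p.1‖ ^ 2) / (1 + inner ℝ p.1 p.2)) s :=
    exists_lipschitzOnWith_of_contDiffAt hs fun p hp =>
      hn1.contDiffAt.div hinner.contDiffAt (hpos p hp).ne'
  have h2 : ∃ C, LipschitzOnWith C (fun p : E3 × E3 => p.2 - p.1) s :=
    exists_lipschitzOnWith_of_contDiffAt hs fun p _ => contDiffAt_snd.sub contDiffAt_fst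
  obtain ⟨C, hC⟩ := ht
  have h3 : ∃ C, LipschitzOnWith C (fun p : E3 × E3 => arctanDivSqrt (tanHalfSq p.1 p.2)) s :=
    ⟨_, lipschitzOnWith_arctanDivSqrt.comp hC hmaps⟩
  have h4 : LipschitzOnWith (4 * (1 * C))
      (fun p : E3 × E3 => 4 * arctanSqrtSq (tanHalfSq p.1 p.2)) s := by
    have := lipschitzOnWith_arctanSqrtSq.comp hC hmaps
    refine LipschitzOnWith.of_dist_le_mul fun p hp q hq => ?_
    have h5 := this.dist_le_mul p hp q hq
    simp only [Function.comp_apply, Real.dist_eq] at h5 ⊢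
    rw [← mul_sub, abs_mul]
    push_cast at h5 ⊢
    norm_num at h5 ⊢
    linarith
  -- The argument of `g'` is a squared distance, hence at most `π²`, so a local Lipschitz condition
  -- is enough.
  have h6 : ∃ C, LipschitzOnWith C (derivWithin g (Ici 0)) (Icc 0 (Real.pi ^ 2)) :=
    (hg'.mono Icc_subset_Ici_self).exists_lipschitzOnWith_of_compact isCompact_Icc
  obtain ⟨C', hC'⟩ := h6
  have h7 : ∃ C, LipschitzOnWith C
      (fun p : E3 × E3 => derivWithin g (Ici 0) (4 * arctanSqrtSq (tanHalfSq p.1 p.2))) s := by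
    refine ⟨_, hC'.comp h4 fun p _ => ⟨mul_nonneg (by norm_num) (sq_nonneg _), ?_⟩⟩
    have h8 := Real.arctan_lt_pi_div_two (√(tanHalfSq p.1 p.2))
    have h9 := Real.arctan_nonneg.2 (Real.sqrt_nonneg (tanHalfSq p.1 p.2))
    rw [arctanSqrtSq]
    nlinarith
  obtain ⟨L, hL⟩ := exists_lipschitzOnWith_smul hs
    (exists_lipschitzOnWith_smul hs h7 (exists_lipschitzOnWith_smul hs h3 h1))
    (exists_lipschitzOnWith_smul hs ⟨0, LipschitzWith.const (2 : ℝ) |>.lipschitzOnWith⟩ h2)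
  refine ⟨L, fun x x' y y' hx hx' hy hy' => ?_⟩
  have h10 := hL.dist_le_mul (x, y) ⟨by simpa using hx, by simpa using hy⟩ (x', y')
    ⟨by simpa using hx', by simpa using hy'⟩
  have h11 : ∀ x y, force g x y = (derivWithin g (Ici 0) (4 * arctanSqrtSq (tanHalfSq x y)) •
      (arctanDivSqrt (tanHalfSq x y) • ((1 + ‖x‖ ^ 2) / (1 + inner ℝ x y)))) •
      ((2 : ℝ) • (y - x)) := by
    intro x y
    rw [force, strength, smul_smul]
    congr 1
    simp only [smul_eq_mul]
    ring
  rw [h11, h11, ← dist_eq_norm]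
  refine h10.trans ?_
  gcongr
  rw [Prod.dist_eq, dist_eq_norm, dist_eq_norm]
  exact max_le_add_of_nonneg (norm_nonneg _) (norm_nonneg _)

end Lipschitz

/-! ### Transfer of curves and disks between matrices and the chart. -/

section Coordinates

/-- The Rodrigues vector as a function of the matrix entries. -/
def rodFun (M : Fin 3 → Fin 3 → ℝ) : E3 :=
  (1 + (M 0 0 + M 1 1 + M 2 2))⁻¹ • !₂[M 2 1 - M 1 2, M 0 2 - M 2 0, M 1 0 - M 0 1]

theorem rodFun_mat (R : SO3) : rodFun (mat R) = rodrigues R := by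
  rw [rodrigues, Matrix.trace_fin_three]
  rfl

theorem differentiableAt_rodFun {M : Fin 3 → Fin 3 → ℝ} (h : 1 + (M 0 0 + M 1 1 + M 2 2) ≠ 0) :
    DifferentiableAt ℝ rodFun M := by
  have h1 : DifferentiableAt ℝ
      (fun M : Fin 3 → Fin 3 → ℝ => 1 + (M 0 0 + M 1 1 + M 2 2)) M := by fun_prop
  refine DifferentiableAt.smul (h1.inv h) ?_
  rw [differentiableAt_euclidean]
  intro i
  fin_cases i <;> simp <;> fun_prop

theorem one_add_trace_rotFun_ne (x : E3) :
    1 + (rotFun x 0 0 + rotFun x 1 1 + rotFun x 2 2) ≠ 0 := by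
  have h := trace_rotMat x
  rw [Matrix.trace_fin_three] at h
  have hx := one_add_norm_sq_pos x
  change 1 + (rotMat x 0 0 + rotMat x 1 1 + rotMat x 2 2) ≠ 0
  rw [h]
  positivity

/-- Differentiating the identity `rodFun ∘ rotFun = id` gives a left inverse, which converts matrix
velocities into chart velocities. -/
theorem fderiv_rodFun_fderiv_rotFun (x z : E3) :
    fderiv ℝ rodFun (rotFun x) (fderiv ℝ rotFun x z) = z := by
  have h1 : HasFDerivAt (rodFun ∘ rotFun)
      ((fderiv ℝ rodFun (rotFun x)).comp (fderiv ℝ rotFun x)) x :=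
    (differentiableAt_rodFun (one_add_trace_rotFun_ne x)).hasFDerivAt.comp x
      (differentiable_rotFun x).hasFDerivAt
  have h2 : rodFun ∘ rotFun = id := by
    funext y
    exact (rodFun_mat (rot y)).trans (rodrigues_rot y)
  rw [h2] at h1
  exact DFunLike.congr_fun (h1.unique (hasFDerivAt_id x)) z

theorem hasDerivWithinAt_rodrigues {R : ℝ → SO3} {t : ℝ} {s : Set ℝ} {z : E3}
    (hR : 0 < 1 + (mat (R t)).trace)
    (h : ∀ i j, HasDerivWithinAt (fun τ => mat (R τ) i j)
      (fderiv ℝ rotFun (rodrigues (R t)) z i j) s t) :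
    HasDerivWithinAt (fun τ => rodrigues (R τ)) z s t := by
  have h1 : HasDerivWithinAt (fun τ => (fun i j => mat (R τ) i j : Fin 3 → Fin 3 → ℝ))
      (fderiv ℝ rotFun (rodrigues (R t)) z) s t :=
    hasDerivWithinAt_pi.2 fun i => hasDerivWithinAt_pi.2 fun j => h i j
  have h2 : (fun i j => mat (R t) i j : Fin 3 → Fin 3 → ℝ) = rotFun (rodrigues (R t)) := by
    conv_lhs => rw [← rot_rodrigues hR]
    rfl
  have h3 : HasFDerivAt rodFun (fderiv ℝ rodFun (rotFun (rodrigues (R t))))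
      (fun i j => mat (R t) i j : Fin 3 → Fin 3 → ℝ) := by
    rw [h2]
    exact (differentiableAt_rodFun (one_add_trace_rotFun_ne _)).hasFDerivAt
  have h4 := h3.comp_hasDerivWithinAt t h1
  rw [fderiv_rodFun_fderiv_rotFun] at h4
  refine h4.congr (fun τ _ => (rodFun_mat _).symm) (rodFun_mat _).symm

theorem hasDerivWithinAt_rot {X : ℝ → E3} {t : ℝ} {s : Set ℝ} {z : E3}
    (h : HasDerivWithinAt X z s t) (i j : Fin 3) :
    HasDerivWithinAt (fun τ => mat (rot (X τ)) i j) (fderiv ℝ rotFun (X t) z i j) s t :=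
  hasDerivWithinAt_pi.1 (hasDerivWithinAt_pi.1
    ((differentiable_rotFun (X t)).hasFDerivAt.comp_hasDerivWithinAt t h) i) j

theorem continuous_rot : Continuous rot :=
  Continuous.subtype_mk (f := fun x => rotMat x) (by
    have h : Continuous rotFun := differentiable_rotFun.continuous
    exact h) _

theorem continuousAt_rodrigues {R : SO3} (hR : 0 < 1 + (mat R).trace) :
    ContinuousAt rodrigues R := by
  have h : (rodrigues : SO3 → E3) = fun Q => rodFun (mat Q) := funext fun Q => (rodFun_mat Q).symm
  rw [h]
  refine ContinuousAt.comp (g := rodFun) (f := fun Q : SO3 => (mat Q : Fin 3 → Fin 3 → ℝ)) ?_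
    continuous_mat.continuousAt
  refine (differentiableAt_rodFun ?_).continuousAt
  rw [Matrix.trace_fin_three] at hR
  exact hR.ne'

theorem norm_rodrigues_le_iff {R : SO3} (hR : dist 1 R < Real.pi / 2) {δ : ℝ} (hδ : 0 ≤ δ)
    (hδ' : δ < Real.pi / 2) : ‖rodrigues R‖ ≤ Real.tan (δ / 2) ↔ dist 1 R ≤ δ := by
  have hpi := Real.pi_pos
  rw [dist_one_eq hR, ← Real.arctan_le_arctan_iff, Real.arctan_tan (by linarith) (by linarith)]
  constructor <;> intro h <;> linarith

theorem tan_half_lt_one {δ : ℝ} (hδ : 0 ≤ δ) (hδ' : δ < Real.pi / 2) : Real.tan (δ / 2) < 1 := by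
  have hpi := Real.pi_pos
  rw [← Real.tan_pi_div_four]
  exact Real.tan_lt_tan_of_lt_of_lt_pi_div_two (by linarith) (by linarith) (by linarith)

end Coordinates

/-! ### The velocity field on the disk, in coordinates. -/

section Disk

variable {ε : ℝ}

theorem dist_lt_of_mem (hε : 0 < ε) (Q : D ε) : dist 1 (Q : SO3) < Real.pi / 2 := by
  have h : dist 1 (Q : SO3) < Real.pi / 2 - ε := Q.2
  linarith

theorem rot_rodrigues_disk (hε : 0 < ε) (Q : D ε) : rot (rodrigues Q) = Q :=
  rot_rodrigues (one_add_trace_pos (dist_lt_of_mem hε Q))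

theorem exists_radius_disk (hε : 0 < ε) : ∃ κ < 1, ∀ Q : D ε, ‖rodrigues (Q : SO3)‖ ≤ κ := by
  rcases isEmpty_or_nonempty (D ε) with h | ⟨⟨Q₀⟩⟩
  -- The disk is empty when `ε ≥ π/2`.
  · exact ⟨0, zero_lt_one, fun Q => h.elim Q⟩
  · have h0 : 0 ≤ dist 1 (Q₀ : SO3) := Real.arccos_nonneg _
    have h1 : dist 1 (Q₀ : SO3) < Real.pi / 2 - ε := Q₀.2
    have h2 : 0 ≤ Real.pi / 2 - ε := by linarith
    have h3 : Real.pi / 2 - ε < Real.pi / 2 := by linarith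
    refine ⟨_, tan_half_lt_one h2 h3, fun Q => ?_⟩
    rw [norm_rodrigues_le_iff (dist_lt_of_mem hε Q) h2 h3]
    exact le_of_lt Q.2

theorem continuous_rodrigues_disk (hε : 0 < ε) : Continuous fun Q : D ε => rodrigues (Q : SO3) :=
  continuous_iff_continuousAt.2 fun Q =>
    (continuousAt_rodrigues (one_add_trace_pos (dist_lt_of_mem hε Q))).comp
      continuous_subtype_val.continuousAt

variable {K : SO3 → SO3 → ℝ} {g : ℝ → ℝ}

theorem continuous_force_disk (hε : 0 < ε)
    (hg' : LocallyLipschitzOn (Ici 0) (derivWithin g (Ici 0))) (R : D ε) :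
    Continuous fun Q : D ε => force g (rodrigues (R : SO3)) (rodrigues (Q : SO3)) := by
  obtain ⟨κ, hκ, hκD⟩ := exists_radius_disk hε
  obtain ⟨L, hL⟩ := exists_force_lipschitz hg' hκ
  have h : LipschitzOnWith L (force g (rodrigues (R : SO3))) (closedBall 0 κ) :=
    LipschitzOnWith.of_dist_le_mul fun y hy y' hy' => by
      have := hL _ _ y y' (hκD R) (hκD R) (by simpa using hy) (by simpa using hy')
      rw [sub_self, norm_zero, zero_add] at this
      rwa [dist_eq_norm, dist_eq_norm]
  exact h.continuousOn.comp_continuous (continuous_rodrigues_disk hε) fun Q => by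
    simpa using hκD Q

theorem exists_bound_force_disk (hε : 0 < ε)
    (hg' : LocallyLipschitzOn (Ici 0) (derivWithin g (Ici 0))) (R : D ε) :
    ∃ C, ∀ Q : D ε, ‖force g (rodrigues (R : SO3)) (rodrigues (Q : SO3))‖ ≤ C := by
  obtain ⟨κ, hκ, hκD⟩ := exists_radius_disk hε
  obtain ⟨L, hL⟩ := exists_force_lipschitz hg' hκ
  refine ⟨L * (κ + κ), fun Q => ?_⟩
  have := hL _ _ _ _ (hκD R) (hκD R) (hκD Q) (hκD R)
  have h0 : force g (rodrigues (R : SO3)) (rodrigues (R : SO3)) = 0 := by simp [force]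
  rw [h0, sub_zero, sub_self, norm_zero, zero_add] at this
  refine this.trans ?_
  gcongr
  exact (norm_sub_le _ _).trans (add_le_add (hκD Q) (hκD R))

theorem integrable_force_disk (hε : 0 < ε)
    (hg' : LocallyLipschitzOn (Ici 0) (derivWithin g (Ici 0))) (R : D ε)
    (ν : Measure (D ε)) [IsFiniteMeasure ν] :
    Integrable (fun Q : D ε => force g (rodrigues (R : SO3)) (rodrigues (Q : SO3))) ν := by
  obtain ⟨C, hC⟩ := exists_bound_force_disk hε hg' R
  exact Integrable.of_bound (continuous_force_disk hε hg' R).aestronglyMeasurable C (ae_of_all _ hC)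

/-- The chart differential at `R` does not depend on `Q`, so it comes out of the integral. -/
theorem velocity_eq (hε : 0 < ε) (hK : ∀ R Q, K R Q = g (dist R Q ^ 2))
    (hg : DifferentiableOn ℝ g (Ici 0)) (hg' : LocallyLipschitzOn (Ici 0) (derivWithin g (Ici 0)))
    (ρ : ℝ≥0 → ProbabilityMeasure (D ε)) (R : D ε) (t : ℝ≥0) (i j : Fin 3) :
    velocity K ρ R t i j = fderiv ℝ rotFun (rodrigues (R : SO3))
      (∫ Q : D ε, force g (rodrigues (R : SO3)) (rodrigues (Q : SO3)) ∂(ρ t : Measure (D ε))) i j := by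
  obtain ⟨κ, hκ, hκD⟩ := exists_radius_disk hε
  set x := rodrigues (R : SO3) with hx
  let ℓ : E3 →L[ℝ] ℝ := (ContinuousLinearMap.proj j).comp
    ((ContinuousLinearMap.proj i : (Fin 3 → Fin 3 → ℝ) →L[ℝ] (Fin 3 → ℝ)).comp
      (fderiv ℝ rotFun x))
  have h1 : ∀ Q : D ε, grad (fun S => K S (Q : SO3)) (R : SO3) i j
      = -ℓ (force g x (rodrigues (Q : SO3))) := by
    intro Q
    have := grad_rot hK hg (one_add_inner_pos hκ (hκD R) (hκD Q)) i j
    rw [rot_rodrigues_disk hε, rot_rodrigues_disk hε] at this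
    exact this
  change -∫ Q : D ε, grad (fun S => K S (Q : SO3)) (R : SO3) i j ∂(ρ t : Measure (D ε)) = ℓ _
  simp only [h1]
  rw [integral_neg, neg_neg, ContinuousLinearMap.integral_comp_comm]
  exact integrable_force_disk hε hg' R _

end Disk

/-! ### Uniqueness and existence of weak solutions. -/

section WellPosed

variable {ε : ℝ} {K : SO3 → SO3 → ℝ} {g : ℝ → ℝ}

/-- `IsGlobalWeakSolution`, with the initial measure as a separate argument. -/
def IsWeakSolutionFrom {U : Set SO3} (K : SO3 → SO3 → ℝ) (μ : ProbabilityMeasure U)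
    (ρ : ℝ≥0 → ProbabilityMeasure U) : Prop :=
  ∃ Ψ : (μ : Measure U).support → ℝ≥0 → U,
    IsGlobalFlowMap (velocity K ρ) (μ : Measure U).support Ψ ∧
    (∀ Φ, IsGlobalFlowMap (velocity K ρ) (μ : Measure U).support Φ → Φ = Ψ) ∧
    ∀ t : ℝ≥0, Measurable (fun R => Ψ R t) ∧
      (ρ t : Measure U) = ((μ : Measure U).comap Subtype.val).map (fun R => Ψ R t)

/-- With the initial measure as a parameter, the flow maps of two solutions have the same domain
type and can be compared. -/
theorem isGlobalWeakSolution_iff {U : Set SO3} {ρ : ℝ≥0 → ProbabilityMeasure U}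
    {μ : ProbabilityMeasure U} (h : ρ 0 = μ) :
    IsGlobalWeakSolution K ρ ↔ IsWeakSolutionFrom K μ ρ := by
  subst h
  rfl

instance : SecondCountableTopology SO3 := by
  have : SecondCountableTopology (Matrix (Fin 3) (Fin 3) ℝ) :=
    inferInstanceAs (SecondCountableTopology (Fin 3 → Fin 3 → ℝ))
  exact TopologicalSpace.Subtype.secondCountableTopology _

/-- The support has full measure, by second countability. -/
theorem map_val_comap_support (μ : Measure (D ε)) :
    (μ.comap (Subtype.val : μ.support → D ε)).map Subtype.val = μ := by
  rw [map_comap_subtype_coe Measure.isClosed_support.measurableSet,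
    Measure.restrict_eq_self_of_ae_mem (s := μ.support) Measure.support_mem_ae]

theorem isProbabilityMeasure_comap_support (μ : Measure (D ε)) [IsProbabilityMeasure μ] :
    IsProbabilityMeasure (μ.comap (Subtype.val : μ.support → D ε)) := by
  constructor
  have h := congrArg (fun ν => ν univ) (map_val_comap_support μ)
  simpa [Measure.map_apply measurable_subtype_coe MeasurableSet.univ] using h

theorem hasDerivWithinAt_rodrigues_flow (hε : 0 < ε) (hK : ∀ R Q, K R Q = g (dist R Q ^ 2))
    (hg : DifferentiableOn ℝ g (Ici 0)) (hg' : LocallyLipschitzOn (Ici 0) (derivWithin g (Ici 0)))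
    {ρ : ℝ≥0 → ProbabilityMeasure (D ε)} {S : Set (D ε)} {Ψ : S → ℝ≥0 → D ε}
    (hΨ : IsGlobalFlowMap (velocity K ρ) S Ψ) (p : S) (t : ℝ) (ht : 0 ≤ t) :
    HasDerivWithinAt (fun s : ℝ => rodrigues (Ψ p s.toNNReal : SO3))
      (∫ Q : D ε, force g (rodrigues (Ψ p t.toNNReal : SO3)) (rodrigues (Q : SO3))
        ∂(ρ t.toNNReal : Measure (D ε))) (Ici 0) t := by
  refine hasDerivWithinAt_rodrigues (R := fun s : ℝ => (Ψ p s.toNNReal : SO3))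
    (one_add_trace_pos (dist_lt_of_mem hε _)) fun i j => ?_
  have h := (hΨ p).2 t.toNNReal i j
  rw [velocity_eq hε hK hg hg', Real.coe_toNNReal t ht] at h
  exact h

theorem flowMap_eq_of_norm_velocity_sub_le (hε : 0 < ε) (hK : ∀ R Q, K R Q = g (dist R Q ^ 2))
    (hg : DifferentiableOn ℝ g (Ici 0)) (hg' : LocallyLipschitzOn (Ici 0) (derivWithin g (Ici 0)))
    {ρ σ : ℝ≥0 → ProbabilityMeasure (D ε)} {S : Set (D ε)} {Φ Ψ : S → ℝ≥0 → D ε}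
    (hΦ : IsGlobalFlowMap (velocity K ρ) S Φ) (hΨ : IsGlobalFlowMap (velocity K σ) S Ψ)
    {C : ℝ} (hC : 0 ≤ C)
    (bound : ∀ t c, (∀ q, ‖rodrigues (Φ q t : SO3) - rodrigues (Ψ q t : SO3)‖ ≤ c) → ∀ p,
      ‖∫ Q : D ε, force g (rodrigues (Φ p t : SO3)) (rodrigues (Q : SO3)) ∂(ρ t : Measure (D ε))
        - ∫ Q : D ε, force g (rodrigues (Ψ p t : SO3)) (rodrigues (Q : SO3))
          ∂(σ t : Measure (D ε))‖ ≤ C * c) :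
    Φ = Ψ := by
  obtain ⟨κ, hκ, hκD⟩ := exists_radius_disk hε
  have h := eqOn_of_norm_deriv_sub_le (b := κ + κ) (C := C)
    (hasDerivWithinAt_rodrigues_flow hε hK hg hg' hΦ)
    (hasDerivWithinAt_rodrigues_flow hε hK hg hg' hΨ)
    (fun p => by rw [Real.toNNReal_zero, (hΦ p).1, (hΨ p).1]) hC
    (fun p t _ => (norm_sub_le _ _).trans (add_le_add (hκD _) (hκD _)))
    (fun t _ c hc p => bound t.toNNReal c hc p)
  funext p t
  have h1 := h p t t.2
  simp only [Real.toNNReal_coe] at h1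
  have h2 := congrArg rot h1
  rw [rot_rodrigues_disk hε, rot_rodrigues_disk hε] at h2
  exact Subtype.ext h2

theorem flowMap_unique (hε : 0 < ε) (hK : ∀ R Q, K R Q = g (dist R Q ^ 2))
    (hg : DifferentiableOn ℝ g (Ici 0)) (hg' : LocallyLipschitzOn (Ici 0) (derivWithin g (Ici 0)))
    {ρ : ℝ≥0 → ProbabilityMeasure (D ε)} {S : Set (D ε)} {Φ Ψ : S → ℝ≥0 → D ε}
    (hΦ : IsGlobalFlowMap (velocity K ρ) S Φ) (hΨ : IsGlobalFlowMap (velocity K ρ) S Ψ) :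
    Φ = Ψ := by
  obtain ⟨κ, hκ, hκD⟩ := exists_radius_disk hε
  obtain ⟨L, hL⟩ := exists_force_lipschitz hg' hκ
  refine flowMap_eq_of_norm_velocity_sub_le hε hK hg hg' hΦ hΨ L.2 fun t c hc p => ?_
  rw [← integral_sub (integrable_force_disk hε hg' _ _) (integrable_force_disk hε hg' _ _)]
  refine (norm_integral_le_of_norm_le_const (C := L * c) (ae_of_all _ fun Q => ?_)).trans (by simp)
  refine (hL _ _ _ _ (hκD _) (hκD _) (hκD Q) (hκD Q)).trans ?_
  rw [sub_self, norm_zero, add_zero]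
  gcongr
  exact hc p

theorem integral_force_map (hε : 0 < ε)
    (hg' : LocallyLipschitzOn (Ici 0) (derivWithin g (Ici 0)))
    {S : Type*} [MeasurableSpace S] {μ : Measure S} {f : S → D ε} (hf : Measurable f) (R : D ε) :
    ∫ Q : D ε, force g (rodrigues (R : SO3)) (rodrigues (Q : SO3)) ∂(μ.map f)
      = ∫ q, force g (rodrigues (R : SO3)) (rodrigues (f q : SO3)) ∂μ :=
  integral_map hf.aemeasurable (continuous_force_disk hε hg' R).aestronglyMeasurable

theorem integrable_force_comp (hε : 0 < ε)
    (hg' : LocallyLipschitzOn (Ici 0) (derivWithin g (Ici 0)))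
    {S : Type*} [MeasurableSpace S] {μ : Measure S} [IsFiniteMeasure μ] {f : S → D ε}
    (hf : Measurable f) (R : D ε) :
    Integrable (fun q => force g (rodrigues (R : SO3)) (rodrigues (f q : SO3))) μ :=
  (integrable_force_disk hε hg' R (μ.map f)).comp_measurable hf

theorem weakSolution_unique (hε : 0 < ε) (hK : ∀ R Q, K R Q = g (dist R Q ^ 2))
    (hg : DifferentiableOn ℝ g (Ici 0)) (hg' : LocallyLipschitzOn (Ici 0) (derivWithin g (Ici 0)))
    {μ : ProbabilityMeasure (D ε)} {ρ σ : ℝ≥0 → ProbabilityMeasure (D ε)}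
    (hρ : IsWeakSolutionFrom K μ ρ) (hσ : IsWeakSolutionFrom K μ σ) : ρ = σ := by
  obtain ⟨Φ, hΦ, -, hΦρ⟩ := hρ
  obtain ⟨Ψ, hΨ, -, hΨσ⟩ := hσ
  obtain ⟨κ, hκ, hκD⟩ := exists_radius_disk hε
  obtain ⟨L, hL⟩ := exists_force_lipschitz hg' hκ
  have := isProbabilityMeasure_comap_support (μ : Measure (D ε))
  have h : Φ = Ψ := by
    -- Both the moving point and the integration variable differ between the two flows, and each
    -- contributes `L * c`.
    refine flowMap_eq_of_norm_velocity_sub_le hε hK hg hg' hΦ hΨ (C := 2 * L) (by positivity)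
      fun t c hc p => ?_
    rw [(hΦρ t).2, (hΨσ t).2, integral_force_map hε hg' (hΦρ t).1,
      integral_force_map hε hg' (hΨσ t).1, ← integral_sub
        (integrable_force_comp hε hg' (hΦρ t).1 _) (integrable_force_comp hε hg' (hΨσ t).1 _)]
    refine (norm_integral_le_of_norm_le_const (C := 2 * L * c)
      (ae_of_all _ fun q => ?_)).trans (by simp)
    refine (hL _ _ _ _ (hκD _) (hκD _) (hκD _) (hκD _)).trans ?_
    rw [mul_comm 2, mul_assoc, two_mul]
    gcongr
    · exact hc p
    · exact hc q
  funext t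
  apply Subtype.ext
  have h1 := (hΦρ t).2
  have h2 := (hΨσ t).2
  rw [h] at h1
  exact h1.trans h2.symm

theorem exists_weakSolution (hε : 0 < ε) (hK : ∀ R Q, K R Q = g (dist R Q ^ 2))
    (hg : DifferentiableOn ℝ g (Ici 0)) (hg' : LocallyLipschitzOn (Ici 0) (derivWithin g (Ici 0)))
    (hpos : ∀ s, 0 ≤ s → 0 ≤ derivWithin g (Ici 0) s) {r : ℝ} (hr : r < Real.pi / 2 - ε)
    (μ : ProbabilityMeasure (D ε))
    (hμ : ∀ R ∈ (μ : Measure (D ε)).support, (R : SO3) ∈ closedDisk r) :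
    ∃ ρ : C(ℝ≥0, ProbabilityMeasure (D ε)), IsWeakSolutionFrom K μ ρ ∧ ρ 0 = μ ∧
      ∀ t, ∀ R ∈ (ρ t : Measure (D ε)).support, (R : SO3) ∈ closedDisk r := by
  -- A probability measure has nonempty support, which rules out negative `r`.
  have hr0 : 0 ≤ r := by
    obtain ⟨R, hR⟩ := Measure.nonempty_support (IsProbabilityMeasure.ne_zero (μ : Measure (D ε)))
    exact (Real.arccos_nonneg _).trans (hμ R hR)
  have hr' : r < Real.pi / 2 := by linarith
  have hκ : Real.tan (r / 2) < 1 := tan_half_lt_one hr0 hr'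
  -- This is the radius of the image of the closed disk, since `dist 1 (rot x) = 2 * arctan ‖x‖`.
  set κ := Real.tan (r / 2) with hκ_def
  have hκ0 : 0 ≤ κ := Real.tan_nonneg_of_nonneg_of_le_pi_div_two (by linarith) (by linarith)
  set S := (μ : Measure (D ε)).support
  set ν : Measure S := (μ : Measure (D ε)).comap Subtype.val with hν
  have hνp : IsProbabilityMeasure ν := isProbabilityMeasure_comap_support (μ : Measure (D ε))
  obtain ⟨L, hL⟩ := exists_force_lipschitz hg' hκ
  obtain ⟨X, hX0, hXc, hXκ, hX⟩ := exists_meanField_solution_of_attractive ν (a := strength g)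
    hκ0 L.2 (fun x y hx hy => strength_nonneg hpos (one_add_inner_pos hκ hx hy)) hL
    (fun p : S => rodrigues ((p : D ε) : SO3))
    ((continuous_rodrigues_disk hε).comp continuous_subtype_val)
    (fun p => (norm_rodrigues_le_iff (dist_lt_of_mem hε p) hr0 hr').2 (hμ p p.2))
  have hdisk : ∀ p (t : ℝ≥0), dist 1 (rot (X p t)) ≤ r := by
    intro p t
    have h1 := Real.arctan_le_arctan_iff.2 (hXκ p t t.2)
    rw [hκ_def, Real.arctan_tan (by linarith) (by linarith)] at h1
    rw [dist_one_rot]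
    linarith
  let Ψ : S → ℝ≥0 → D ε := fun p t => ⟨rot (X p t), (hdisk p t).trans_lt hr⟩
  have hΨX : ∀ p t, rodrigues (Ψ p t : SO3) = X p t := fun p t => rodrigues_rot _
  have hΨm : ∀ t, Measurable fun p => Ψ p t := fun t =>
    ((continuous_rot.comp (hXc t)).subtype_mk _).measurable
  have hΨc : ∀ p, Continuous fun t => Ψ p t := by
    intro p
    have h1 : ContinuousOn (X p) (Ici 0) := fun t ht => (hX p t ht).continuousWithinAt
    exact (continuous_rot.comp
      (h1.comp_continuous NNReal.continuous_coe fun t => t.2)).subtype_mk _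
  let ρ : ℝ≥0 → ProbabilityMeasure (D ε) := fun t =>
    ⟨ν.map fun p => Ψ p t, Measure.isProbabilityMeasure_map (hΨm t).aemeasurable⟩
  have hρ : ∀ t, (ρ t : Measure (D ε)) = ν.map fun p => Ψ p t := fun t => rfl
  -- Narrow continuity follows from continuity of each trajectory by dominated convergence.
  have hρc : Continuous ρ := by
    refine continuous_iff_continuousAt.2 fun t => ?_
    refine ProbabilityMeasure.tendsto_iff_forall_integral_tendsto.2 fun f => ?_
    simp only [hρ]
    simp only [integral_map (hΨm _).aemeasurable f.continuous.aestronglyMeasurable]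
    refine tendsto_integral_filter_of_dominated_convergence (fun _ => ‖f‖)
      (Eventually.of_forall fun s => (f.continuous.measurable.comp (hΨm s)).aestronglyMeasurable)
      (Eventually.of_forall fun s => ae_of_all _ fun p => f.norm_coe_le_norm _)
      (integrable_const _) (ae_of_all _ fun p => ?_)
    exact (f.continuous.comp (hΨc p)).tendsto t
  have hΨ0 : ∀ p : S, Ψ p 0 = p := by
    intro p
    apply Subtype.ext
    change rot (X p ((0 : ℝ≥0) : ℝ)) = _
    rw [NNReal.coe_zero, hX0, rot_rodrigues_disk hε]
  have hflow : IsGlobalFlowMap (velocity K ρ) S Ψ := by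
    refine fun p => ⟨hΨ0 p, fun t i j => ?_⟩
    rw [velocity_eq hε hK hg hg', hρ, integral_force_map hε hg' (hΨm t)]
    simp only [hΨX]
    refine (hasDerivWithinAt_rot (hX p t t.2) i j).congr (fun s hs => ?_) ?_
    · change mat (rot (X p (s.toNNReal : ℝ))) i j = _
      rw [Real.coe_toNNReal s hs]
    · change mat (rot (X p ((t : ℝ).toNNReal : ℝ))) i j = _
      rw [Real.toNNReal_coe]
  refine ⟨⟨ρ, hρc⟩, ⟨Ψ, hflow, fun Φ hΦ => flowMap_unique hε hK hg hg' hΦ hflow,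
    fun t => ⟨hΨm t, rfl⟩⟩, ?_, fun t R hR => ?_⟩
  · apply Subtype.ext
    change ν.map (fun p => Ψ p 0) = μ
    simp only [hΨ0]
    exact map_val_comap_support _
  · have hcl : IsClosed {R : D ε | (R : SO3) ∈ closedDisk r} :=
      isClosed_le (continuous_dist_one.comp continuous_subtype_val) continuous_const
    refine Measure.support_subset_of_isClosed hcl ?_ hR
    change _ ∈ ae (ν.map fun p => Ψ p t)
    rw [mem_ae_map_iff (hΨm t).aemeasurable hcl.measurableSet]
    exact univ_mem' fun p => hdisk p t

end WellPosed

end AggSO3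

end

theorem mainTheorem2 (K : AggSO3.SO3 → AggSO3.SO3 → ℝ) (g : ℝ → ℝ)
    (hK : ∀ R Q, K R Q = g (AggSO3.dist R Q ^ 2))
    (hg : DifferentiableOn ℝ g (Set.Ici 0))
    (hg' : LocallyLipschitzOn (Set.Ici 0) (derivWithin g (Set.Ici 0)))
    (hpos : ∀ s, 0 ≤ s → 0 ≤ derivWithin g (Set.Ici 0) s)
    (ε r : ℝ) (hε : 0 < ε) (hr : r < Real.pi / 2 - ε)
    (ρ₀ : MeasureTheory.ProbabilityMeasure (AggSO3.D ε))
    (hρ₀ : ∀ R ∈ (ρ₀ : MeasureTheory.Measure (AggSO3.D ε)).support,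
      (R : AggSO3.SO3) ∈ AggSO3.closedDisk r) :
    ∃ ρ : C(NNReal, MeasureTheory.ProbabilityMeasure (AggSO3.D ε)),
      AggSO3.IsGlobalWeakSolution K ρ ∧ ρ 0 = ρ₀ ∧
      (∀ t, ∀ R ∈ (ρ t : MeasureTheory.Measure (AggSO3.D ε)).support,
        (R : AggSO3.SO3) ∈ AggSO3.closedDisk r) ∧
      ∀ σ : C(NNReal, MeasureTheory.ProbabilityMeasure (AggSO3.D ε)),
        AggSO3.IsGlobalWeakSolution K σ → σ 0 = ρ₀ → σ = ρ := by
  obtain ⟨ρ, hρ, hρ0, hsupp⟩ := AggSO3.exists_weakSolution hε hK hg hg' hpos hr ρ₀ hρ₀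
  refine ⟨ρ, (AggSO3.isGlobalWeakSolution_iff hρ0).2 hρ, hρ0, hsupp, fun σ hσ hσ0 => ?_⟩
  exact DFunLike.coe_injective (AggSO3.weakSolution_unique hε hK hg hg'
    ((AggSO3.isGlobalWeakSolution_iff hσ0).1 hσ) hρ)
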